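/- Let $n\ge 1$, $N\ge 0$ be integers, $\eta\in\mathbb C\setminus\{0\}$, $K$ any complex $n\times n$ matrix, and let $\xi_1,\dots,\xi_N\in\mathbb C$ be in generic position: $\xi_a-\xi_b\neq r\eta$ for all $a\ne b$ and all integers $r$ with $|r|\le n-1$. On tensor products of copies of $\mathbb C^n$ let $R_{a,b}(\lambda)=\lambda I+\eta\,\mathbb P_{a,b}$, with $\mathbb P_{a,b}$ the permutation operator of the factors $a,b$, and on $V_a\otimes\mathcal H$, $V_a=\mathbb C^n$, $\mathcal H=(\mathbb C^n)^{\otimes N}$, let $$M_a^{(K)}(\lambda)=K_a R_{a,N}(\lambda-\xi_N)\cdots R_{a,1}(\lambda-\xi_1).$$ With $P^-_{1,\dots,m}=\frac1{m!}\sum_{\pi\in S_m}\mathrm{sgn}(\pi)P_\pi$ the antisymmetrizer on $(\mathbb C^n)^{\otimes m}$, define for $1\le m\le n$ the fused transfer matrices $$T_m^{(K)}(\lambda)=\mathrm{tr}_{1,\dots,m}\big[P^-_{1,\dots,m}M_1^{(K)}(\lambda)M_2^{(K)}(\lambda-\eta)\cdots M_m^{(K)}(\lambda-(m-1)\eta)\big]\in\mathrm{End}(\mathcal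 H)$$ and the scalars $T_m^{(K,\infty)}=\mathrm{tr}_{1,\dots,m}[P^-_{1,\dots,m}K_1K_2\cdots K_m]$. (i) For all $1\le m\le n-1$ and $\lambda\in\mathbb C$, $$T_{m+1}^{(K)}(\lambda)=\prod_{b=1}^N\prod_{r=1}^m(\lambda-\xi_b-r\eta)\Big[T_{m+1}^{(K,\infty)}\prod_{b=1}^N(\lambda-\xi_b)\,I+\sum_{a=1}^N g_a^{(m+1)}(\lambda)\,T_m^{(K)}(\xi_a-\eta)\,T_1^{(K)}(\xi_a)\Big],$$ where $$g_a^{(m+1)}(\lambda)=\prod_{b\ne a}\frac{\lambda-\xi_b}{\xi_a-\xi_b}\ \prod_{b=1}^N\prod_{r=1}^m\frac1{\xi_a-\xi_b-r\eta}.$$ (ii) $T_1^{(K)}$ characterizes all the higher transfer matrices through the fusion equations, the central zeros and the asymptotics: for functions $S_1,\dots,S_n:\mathbb C\to\mathrm{End}(\mathcal H)$ one has $S_m=T_m^{(K)}$ for all $1\le m\le n$ if and only if $S_1=T_1^{(K)}$ and, for every $1\le m\le n-1$, $S_{m+1}$ is polynomial in $\lambda$, $\lim_{\lambda\to\infty}\lambda^{-(m+1)N}S_{m+1}(\lambda)=T_{m+1}^{(K,\infty)}I$,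 $S_{m+1}(\xi_a)=S_1(\xi_a)S_m(\xi_a-\eta)$ for all $a$, and $S_{m+1}(\xi_a+r\eta)=0$ for all $a$ and all $1\le r\le m$. -/

import Mathlib

noncomputable section

open Filter Topology

namespace FusedTransfer

/-- Operators on the tensor product `⨂_{i : ι} ℂⁿ`, written as matrices in the product basis
`e_x = ⨂_i e_{x i}`, `x : ι → Fin n`. -/
abbrev TensorOp (n : ℕ) (ι : Type) : Type := Matrix (ι → Fin n) (ι → Fin n) ℂ

/-- The operator `P_π`, `P_π (⨂_i v_i) = ⨂_i v_{π i}`; on the basis, `P_π e_x = e_{x ∘ π}`. -/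
def permOp {n : ℕ} {ι : Type} [Fintype ι] [DecidableEq ι] (π : Equiv.Perm ι) : TensorOp n ι :=
  Matrix.of fun y x => if y = x ∘ π then 1 else 0

/-- The operator `K_i`: the matrix `K` acting on the `i`-th tensor factor, the identity on the
other factors. -/
def siteOp {n : ℕ} {ι : Type} [Fintype ι] [DecidableEq ι] (K : Matrix (Fin n) (Fin n) ℂ) (i : ι) :
    TensorOp n ι :=
  Matrix.of fun y x => if ∀ j, j ≠ i → y j = x j then K (y i) (x i) else 0

/-- The rational `gl_n` `R`-matrix `R_{i,j}(u) = u I + η ℙ_{i,j}` acting on the factors `i`, `j`. -/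
def rMatrix {n : ℕ} {ι : Type} [Fintype ι] [DecidableEq ι] (η : ℂ) (i j : ι) (u : ℂ) :
    TensorOp n ι :=
  u • (1 : TensorOp n ι) + η • permOp (Equiv.swap i j)

/-- The monodromy matrix
`M_a(u) = K_a R_{a,N}(u - ξ_N) ⋯ R_{a,1}(u - ξ_1)`, as an operator on
`(ℂⁿ)^{⊗ m} ⊗ (ℂⁿ)^{⊗ N}`; the auxiliary spaces are indexed by `Fin m` and the quantum
spaces (the lattice sites) by `Fin N`. -/
def monodromy {n N : ℕ} (m : ℕ) (η : ℂ) (ξ : Fin N → ℂ) (K : Matrix (Fin n) (Fin n) ℂ)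
    (a : Fin m) (u : ℂ) : TensorOp n (Fin m ⊕ Fin N) :=
  siteOp K (Sum.inl a) *
    ((List.finRange N).reverse.map fun b => rMatrix η (Sum.inl a) (Sum.inr b) (u - ξ b)).prod

/-- The antisymmetrizer `P⁻_{1,…,m} = (1/m!) ∑_π sgn(π) P_π` on `(ℂⁿ)^{⊗ m}`. -/
def antisymmetrizer (n m : ℕ) : TensorOp n (Fin m) :=
  ((m.factorial : ℂ)⁻¹) •
    ∑ π : Equiv.Perm (Fin m), ((Equiv.Perm.sign π : ℤ) : ℂ) • permOp π

/-- The operator `A ⊗ 1` on `(ℂⁿ)^{⊗ m} ⊗ (ℂⁿ)^{⊗ N}` for an operator `A` on the auxiliary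
spaces. -/
def auxOp {n m : ℕ} (N : ℕ) (A : TensorOp n (Fin m)) : TensorOp n (Fin m ⊕ Fin N) :=
  Matrix.of fun y x => if y ∘ Sum.inr = x ∘ Sum.inr then A (y ∘ Sum.inl) (x ∘ Sum.inl) else 0

/-- The partial trace `tr_{1,…,m}` over all the auxiliary spaces. -/
def auxTrace {n m N : ℕ} (X : TensorOp n (Fin m ⊕ Fin N)) : TensorOp n (Fin N) :=
  Matrix.of fun s t => ∑ c : Fin m → Fin n, X (Sum.elim c s) (Sum.elim c t)

/-- The fused transfer matrix
`T_m(u) = tr_{1,…,m} [P⁻_{1,…,m} M_1(u) M_2(u - η) ⋯ M_m(u - (m-1) η)]`.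
(`a : Fin m` starts at `0`.) -/
def transfer {n N : ℕ} (η : ℂ) (ξ : Fin N → ℂ) (K : Matrix (Fin n) (Fin n) ℂ) (m : ℕ) (u : ℂ) :
    TensorOp n (Fin N) :=
  auxTrace (auxOp N (antisymmetrizer n m) *
    ((List.finRange m).map fun a => monodromy m η ξ K a (u - ((a : ℕ) : ℂ) * η)).prod)

/-- The asymptotic coefficient `T_m^∞ = tr_{1,…,m} [P⁻_{1,…,m} K_1 K_2 ⋯ K_m]`. -/
def transferInf {n : ℕ} (K : Matrix (Fin n) (Fin n) ℂ) (m : ℕ) : ℂ :=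
  Matrix.trace (antisymmetrizer n m * ((List.finRange m).map fun a => siteOp K a).prod)

/-- The shifted inhomogeneities `ξ_b^{(h)} = ξ_b - h η`. -/
def xiShift {N : ℕ} (η : ℂ) (ξ : Fin N → ℂ) (b : Fin N) (h : ℤ) : ℂ := ξ b - (h : ℂ) * η

/-- `g_{a,h}^{(m)}(u) = ∏_{b ≠ a} (u - ξ_b^{(h_b)}) / (ξ_a^{(h_a)} - ξ_b^{(h_b)})
· ∏_b ∏_{r=1}^{m-1} 1 / (ξ_a^{(h_a)} - ξ_b^{(-r)})`. -/
def gFun {N : ℕ} (η : ℂ) (ξ : Fin N → ℂ) (m : ℕ) (a : Fin N) (h : Fin N → ℤ) (u : ℂ) : ℂ :=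
  (∏ b ∈ Finset.univ.erase a,
      (u - xiShift η ξ b (h b)) / (xiShift η ξ a (h a) - xiShift η ξ b (h b))) *
    ∏ b, ∏ r ∈ Finset.Ico 1 m, 1 / (xiShift η ξ a (h a) - xiShift η ξ b (-(r : ℤ)))

/-- `T_{m,h}^∞(u) = T_m^∞ ∏_b (u - ξ_b^{(h_b)})`. -/
def transferInfFun {n N : ℕ} (η : ℂ) (ξ : Fin N → ℂ) (K : Matrix (Fin n) (Fin n) ℂ) (m : ℕ)
    (h : Fin N → ℤ) (u : ℂ) : ℂ :=
  transferInf K m * ∏ b, (u - xiShift η ξ b (h b))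

/-- `F` is an operator-valued polynomial in `u` (all matrix elements are polynomial). -/
def IsPolynomialOp {n N : ℕ} (F : ℂ → TensorOp n (Fin N)) : Prop :=
  ∀ s t, ∃ p : Polynomial ℂ, ∀ u, F u s t = p.eval u

/-- `F` has the asymptotic behaviour `lim_{u → ∞} u^{-d} F(u) = c · 1`. -/
def HasAsymptotics {n N : ℕ} (F : ℂ → TensorOp n (Fin N)) (d : ℕ) (c : ℂ) : Prop :=
  Tendsto (fun u : ℂ => (u ^ d)⁻¹ • F u) (Bornology.cobounded ℂ) (𝓝 (c • (1 : TensorOp n (Fin N))))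

end FusedTransfer

end

open FusedTransfer

/-! A polynomial `T_{m+1}` whose asymptotics at order `(m+1)N` are known is determined by its values
at `(m+1)N` distinct points. The points `ξ_a + rη`, `0 ≤ r ≤ m`, are distinct by genericity, and the
values there are the fusion product `T_1(ξ_a) T_m(ξ_a - η)` for `r = 0` and zero for `r ≥ 1`. Both
parts of the theorem are this uniqueness statement (`eq_of_eq_at_points`): in (i) it compares
`T_{m+1}` with an explicit interpolant, in (ii) it drives an induction on `m`.

The values come from the RTT relation. At spectral difference `η` the braided `R`-matrix degenerates
to `η(1 + P)`. At `u = ξ_a` the Lax factor of site `a` also degenerates: `M_1(ξ_a) M_2(ξ_a - η)` is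
antisymmetric on the left and `M_1(ξ_a + η) M_2(ξ_a)` is symmetric on the right (`monoOp_antisymm`,
`monoOp_symm`). The symmetry cancels the antisymmetrized trace at `ξ_a + rη` (`altTrace_eq_zero`).
The antisymmetry lets the antisymmetrizer over all auxiliary spaces be replaced by the one omitting
the first, so the trace factorizes (`altTrace_fusion`).

Fusion yields the order `T_1 T_m`, whereas (i) has `T_m T_1`; `transfer_commute` reconciles them. -/

noncomputable section

open Filter Topology

namespace FusedTransfer

/-! ### One-site operators with coefficients in a noncommutative ring -/

section LocalOp

variable {n : ℕ} {ι : Type} [Fintype ι] [DecidableEq ι] {R : Type*} [Ring R]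

/-- The operator acting as `X` on the `i`-th tensor factor, with coefficients in a ring `R`. -/
def localOp (X : Matrix (Fin n) (Fin n) R) (i : ι) : Matrix (ι → Fin n) (ι → Fin n) R :=
  Matrix.of fun y x => if ∀ j, j ≠ i → y j = x j then X (y i) (x i) else 0

theorem siteOp_eq_localOp (K : Matrix (Fin n) (Fin n) ℂ) (i : ι) : siteOp K i = localOp K i := rfl

theorem localOp_apply (X : Matrix (Fin n) (Fin n) R) (i : ι) (y x : ι → Fin n) :
    localOp X i y x = if ∀ j, j ≠ i → y j = x j then X (y i) (x i) else 0 := rfl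

theorem localOp_mul_apply (X : Matrix (Fin n) (Fin n) R) (i : ι)
    (Z : Matrix (ι → Fin n) (ι → Fin n) R) (y x : ι → Fin n) :
    (localOp X i * Z) y x = ∑ k, X (y i) k * Z (Function.update y i k) x := by
  rw [Matrix.mul_apply]
  symm
  refine Finset.sum_of_injOn (fun k => Function.update y i k) ?_ ?_ ?_ ?_
  · intro k _ l _ h
    simpa using congrFun h i
  · intro k _; simp
  · intro z _ hz
    rw [localOp_apply, if_neg, zero_mul]
    intro h
    refine hz ⟨z i, by simp, ?_⟩
    funext j
    by_cases hj : j = i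
    · subst hj; simp
    · simp [hj, h j hj]
  · intro k _
    rw [localOp_apply, if_pos, Function.update_self]
    intro j hj
    simp [hj]

theorem localOp_mul (X Y : Matrix (Fin n) (Fin n) R) (i : ι) :
    localOp X i * localOp Y i = localOp (X * Y) i := by
  ext y x
  rw [localOp_mul_apply, localOp_apply]
  have h : ∀ k, (∀ j, j ≠ i → Function.update y i k j = x j) ↔ ∀ j, j ≠ i → y j = x j := by
    intro k
    refine forall₂_congr fun j hj => ?_
    simp [hj]
  simp only [localOp_apply, h, Function.update_self]
  split_ifs
  · rw [Matrix.mul_apply]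
  · simp

theorem localOp_one (i : ι) : localOp (1 : Matrix (Fin n) (Fin n) R) i = 1 := by
  ext y x
  rw [localOp_apply, Matrix.one_apply, Matrix.one_apply]
  by_cases h : y = x
  · subst h; simp
  · rw [if_neg h]
    split_ifs with h1 h2
    · exfalso
      apply h
      funext j
      by_cases hj : j = i
      · rw [hj, h2]
      · exact h1 j hj
    · rfl
    · rfl

theorem localOp_list_prod (i : ι) (l : List (Matrix (Fin n) (Fin n) R)) :
    (l.map fun X => localOp X i).prod = localOp l.prod i := by
  induction l with
  | nil => simp [localOp_one]
  | cons X l ih => simp [ih, localOp_mul]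

theorem localOp_commute {X Y : Matrix (Fin n) (Fin n) R} {i j : ι} (hij : i ≠ j)
    (h : ∀ a b c d, Commute (X a b) (Y c d)) : Commute (localOp X i) (localOp Y j) := by
  have key : ∀ (X Y : Matrix (Fin n) (Fin n) R) (i j : ι), i ≠ j → ∀ y x : ι → Fin n,
      (localOp X i * localOp Y j) y x =
        if ∀ k, k ≠ i → k ≠ j → y k = x k then X (y i) (x i) * Y (y j) (x j) else 0 := by
    intro X Y i j hij y x
    rw [localOp_mul_apply, Finset.sum_eq_single (x i)]
    · rw [localOp_apply]
      have : (∀ k, k ≠ j → Function.update y i (x i) k = x k) ↔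
          ∀ k, k ≠ i → k ≠ j → y k = x k := by
        refine forall_congr' fun k => ?_
        by_cases hk : k = i
        · subst hk; simp
        · simp [hk]
      simp only [this, Function.update_of_ne hij.symm]
      split_ifs <;> simp
    · intro k _ hk
      rw [localOp_apply, if_neg, mul_zero]
      intro h
      exact hk (by simpa using h i hij)
    · simp
  ext y x
  rw [key X Y i j hij, key Y X j i hij.symm, (h _ _ _ _).eq]
  refine if_congr ⟨fun h k h1 h2 => h k h2 h1, fun h k h1 h2 => h k h2 h1⟩ rfl rfl

/-- Distinct sites do not interfere: the rest of the product leaves site `i` untouched, so the sum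
over its intermediate index collapses to `x i`. The factors keep the order of the list, hence no
commutativity of `R` is needed. -/
theorem localOp_prod_apply (X : ι → Matrix (Fin n) (Fin n) R) (l : List ι) (hl : l.Nodup)
    (y x : ι → Fin n) :
    (l.map fun i => localOp (X i) i).prod y x =
      if ∀ j, j ∉ l → y j = x j then (l.map fun i => X i (y i) (x i)).prod else 0 := by
  induction l generalizing y with
  | nil =>
    simp only [List.map_nil, List.prod_nil, Matrix.one_apply, List.not_mem_nil,
      not_false_eq_true, forall_const, funext_iff]
  | cons i l ih =>
    rw [List.nodup_cons] at hl
    rw [List.map_cons, List.prod_cons, localOp_mul_apply, Finset.sum_eq_single (x i)]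
    · rw [ih hl.2]
      have h1 : (∀ j, j ∉ l → Function.update y i (x i) j = x j) ↔
          ∀ j, j ∉ i :: l → y j = x j := by
        refine forall_congr' fun j => ?_
        by_cases hj : j = i
        · subst hj; simp
        · simp [hj]
      have h2 : (l.map fun k => X k (Function.update y i (x i) k) (x k)) =
          l.map fun k => X k (y k) (x k) := by
        refine List.map_congr_left fun k hk => ?_
        rw [Function.update_of_ne]
        rintro rfl
        exact hl.1 hk
      simp only [h1, h2, List.map_cons, List.prod_cons]
      split_ifs <;> simp
    · intro k _ hk
      rw [ih hl.2, if_neg, mul_zero]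
      intro h
      exact hk (by simpa using h i hl.1)
    · simp

theorem localOp_prod_finRange_apply {m : ℕ} (X : Fin m → Matrix (Fin n) (Fin n) R)
    (y x : Fin m → Fin n) :
    ((List.finRange m).map fun i => localOp (X i) i).prod y x =
      ((List.finRange m).map fun i => X i (y i) (x i)).prod := by
  rw [localOp_prod_apply X _ (List.nodup_finRange m), if_pos]
  intro j hj
  exact absurd (List.mem_finRange j) hj

end LocalOp

/-! ### Operators on auxiliary and quantum spaces as operator-valued matrices -/

section Blocks

variable {n N : ℕ}

/-- The elementary matrix `E_{ij}` acting at the site `b`. -/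
def elemOp (b : Fin N) (i j : Fin n) : TensorOp n (Fin N) := siteOp (Matrix.single i j 1) b

theorem elemOp_mul (b : Fin N) (i j k l : Fin n) :
    elemOp b i j * elemOp b k l = if j = k then elemOp b i l else 0 := by
  rw [elemOp, elemOp, siteOp_eq_localOp, siteOp_eq_localOp, localOp_mul]
  split_ifs with h
  · subst h; simp [elemOp, siteOp_eq_localOp]
  · rw [Matrix.single_mul_single_of_ne (h := h)]
    ext y x
    simp [localOp_apply]

theorem elemOp_commute {b c : Fin N} (h : b ≠ c) (i j k l : Fin n) :
    Commute (elemOp b i j) (elemOp c k l) :=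
  localOp_commute h fun _ _ _ _ => Commute.all _ _

/-- The `R`-matrix `R_{0,b}(u)` as an `n × n` matrix of operators on the quantum space. -/
def laxOp (η : ℂ) (b : Fin N) (u : ℂ) : Matrix (Fin n) (Fin n) (TensorOp n (Fin N)) :=
  Matrix.of fun i j => (if i = j then u • 1 else 0) + η • elemOp b j i

/-- The monodromy matrix as an `n × n` matrix of operators on the quantum space. -/
def monoOp (η : ℂ) (ξ : Fin N → ℂ) (K : Matrix (Fin n) (Fin n) ℂ) (u : ℂ) :
    Matrix (Fin n) (Fin n) (TensorOp n (Fin N)) :=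
  K.map (algebraMap ℂ (TensorOp n (Fin N))) *
    ((List.finRange N).reverse.map fun b => laxOp η b (u - ξ b)).prod

/-- An operator on `(ℂⁿ)^{⊗ m} ⊗ (ℂⁿ)^{⊗ N}` as a matrix of operators on the quantum space. -/
def blocks (n m N : ℕ) : TensorOp n (Fin m ⊕ Fin N) ≃+*
    Matrix (Fin m → Fin n) (Fin m → Fin n) (TensorOp n (Fin N)) :=
  (Matrix.reindexAlgEquiv ℂ ℂ (Equiv.sumArrowEquivProdArrow (Fin m) (Fin N) (Fin n))).toRingEquiv.trans
    (Matrix.compRingEquiv (Fin m → Fin n) (Fin N → Fin n) ℂ).symm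

theorem blocks_apply {m : ℕ} (X : TensorOp n (Fin m ⊕ Fin N)) (c d : Fin m → Fin n)
    (s t : Fin N → Fin n) : blocks n m N X c d s t = X (Sum.elim c s) (Sum.elim d t) := rfl

theorem blocks_siteOp {m : ℕ} (K : Matrix (Fin n) (Fin n) ℂ) (a : Fin m) :
    blocks n m N (siteOp K (Sum.inl a)) =
      localOp (K.map (algebraMap ℂ (TensorOp n (Fin N)))) a := by
  ext c d s t
  rw [blocks_apply, localOp_apply, siteOp_eq_localOp, localOp_apply]
  by_cases h : ∀ j, j ≠ a → c j = d j
  · rw [if_pos h]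
    simp only [Matrix.map_apply, Matrix.algebraMap_matrix_apply, Sum.elim_inl]
    refine if_congr ?_ rfl rfl
    constructor
    · intro h1
      funext j
      simpa using h1 (Sum.inr j) (by simp)
    · rintro rfl (j | j) hj
      · exact h j (by simpa using hj)
      · rfl
  · rw [if_neg h, if_neg, Matrix.zero_apply]
    intro h1
    exact h fun j hj => by simpa using h1 (Sum.inl j) (by simpa using hj)

/-- Since `ℙ = ∑ E_{ij} ⊗ E_{ji}`, the auxiliary block `(i, j)` carries `E_{ji}` on the site; this
is the index reversal in `laxOp`. -/
theorem blocks_rMatrix {m : ℕ} (η : ℂ) (a : Fin m) (b : Fin N) (u : ℂ) :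
    blocks n m N (rMatrix η (Sum.inl a) (Sum.inr b) u) = localOp (laxOp η b u) a := by
  have h1 : localOp (laxOp (n := n) η b u) a =
      localOp (u • (1 : Matrix (Fin n) (Fin n) (TensorOp n (Fin N)))) a +
        localOp (Matrix.of fun i j => η • elemOp b j i) a := by
    ext c d s t
    simp only [localOp_apply, Matrix.add_apply]
    split_ifs
    · simp only [laxOp, Matrix.of_apply, Matrix.add_apply, Matrix.smul_apply, Matrix.one_apply]
      split_ifs <;> simp
    · simp
  have h2 : localOp (u • (1 : Matrix (Fin n) (Fin n) (TensorOp n (Fin N)))) a = u • 1 := by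
    rw [← localOp_one a]
    ext c d s t
    simp only [localOp_apply, Matrix.smul_apply]
    split_ifs <;> simp
  have h3 : blocks n m N (u • 1) = u • 1 := by
    have : u • (1 : Matrix (Fin m → Fin n) (Fin m → Fin n) (TensorOp n (Fin N))) =
      u • blocks n m N 1 := by rw [map_one]
    rw [this]
    rfl
  rw [h1, h2, rMatrix, map_add, h3]
  congr 1
  ext c d s t
  rw [blocks_apply, localOp_apply, Matrix.smul_apply, permOp, Matrix.of_apply]
  simp only [elemOp, siteOp_eq_localOp]
  have key : Sum.elim c s = Sum.elim d t ∘ Equiv.swap (Sum.inl a) (Sum.inr b) ↔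
      (∀ j, j ≠ a → c j = d j) ∧ (∀ j, j ≠ b → s j = t j) ∧ d a = s b ∧ c a = t b := by
    rw [funext_iff]
    constructor
    · intro h
      refine ⟨fun j hj => ?_, fun j hj => ?_, ?_, ?_⟩
      · simpa [Equiv.swap_apply_of_ne_of_ne, hj] using h (Sum.inl j)
      · simpa [Equiv.swap_apply_of_ne_of_ne, hj] using h (Sum.inr j)
      · simpa using (h (Sum.inr b)).symm
      · simpa using h (Sum.inl a)
    · rintro ⟨h1, h2, h3, h4⟩ (j | j)
      · by_cases hj : j = a
        · subst hj; simpa using h4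
        · simpa [Equiv.swap_apply_of_ne_of_ne, hj] using h1 j hj
      · by_cases hj : j = b
        · subst hj; simpa using h3.symm
        · simpa [Equiv.swap_apply_of_ne_of_ne, hj] using h2 j hj
  simp only [key]
  by_cases hc : ∀ j, j ≠ a → c j = d j
  · rw [if_pos hc]
    simp only [Matrix.of_apply, Matrix.smul_apply, localOp_apply, Matrix.single_apply]
    by_cases hs : ∀ j, j ≠ b → s j = t j
    · rw [if_pos hs]
      congr 1
      exact if_congr ⟨fun h => h.2.2, fun h => ⟨hc, hs, h⟩⟩ rfl rfl
    · rw [if_neg hs, if_neg fun h => hs h.2.1]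
  · rw [if_neg hc, if_neg fun h => hc h.1]
    simp

theorem blocks_monodromy {m : ℕ} (η : ℂ) (ξ : Fin N → ℂ) (K : Matrix (Fin n) (Fin n) ℂ)
    (a : Fin m) (u : ℂ) :
    blocks n m N (monodromy m η ξ K a u) = localOp (monoOp η ξ K u) a := by
  rw [monodromy, map_mul, map_list_prod, blocks_siteOp, monoOp, ← localOp_mul,
    ← localOp_list_prod, List.map_map, List.map_map]
  congr 3
  funext b
  exact blocks_rMatrix η a b _

/-- Each `P_π` pins the row index to `c = d ∘ π`, leaving one free sum. -/
theorem antisymmetrizer_mul_trace {m : ℕ} {R : Type*} [AddCommGroup R] [Module ℂ R]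
    (f : (Fin m → Fin n) → (Fin m → Fin n) → R) :
    ∑ c, ∑ d, antisymmetrizer n m c d • f d c = ((m.factorial : ℂ)⁻¹) •
      ∑ π : Equiv.Perm (Fin m), ((Equiv.Perm.sign π : ℤ) : ℂ) • ∑ d, f d (d ∘ π) := by
  simp only [antisymmetrizer, Matrix.smul_apply, Matrix.sum_apply, permOp, Matrix.of_apply,
    smul_assoc, Finset.sum_smul, ← Finset.smul_sum]
  congr 1
  rw [Finset.sum_comm' (t' := Finset.univ) (s' := fun _ => Finset.univ) (by simp)]
  simp only [Finset.sum_comm (s := Finset.univ (α := Fin m → Fin n))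
    (t := Finset.univ (α := Equiv.Perm (Fin m)))]
  refine Finset.sum_congr rfl fun π _ => ?_
  rw [Finset.smul_sum]
  refine Finset.sum_congr rfl fun d _ => ?_
  simp [ite_smul]

/-- `blocks` is a ring isomorphism, the antisymmetrizer has scalar blocks and `M_k` acts on the
auxiliary space `k` alone. The trace therefore becomes a signed sum of ordered products of monodromy
entries. -/
theorem transfer_eq (η : ℂ) (ξ : Fin N → ℂ) (K : Matrix (Fin n) (Fin n) ℂ) (m : ℕ) (u : ℂ) :
    transfer η ξ K m u = ((m.factorial : ℂ)⁻¹) •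
      ∑ π : Equiv.Perm (Fin m), ((Equiv.Perm.sign π : ℤ) : ℂ) • ∑ d : Fin m → Fin n,
        ((List.finRange m).map fun k : Fin m =>
          monoOp η ξ K (u - ((k : ℕ) : ℂ) * η) (d k) (d (π k))).prod := by
  have h := antisymmetrizer_mul_trace (n := n) fun d c : Fin m → Fin n =>
    ((List.finRange m).map fun k : Fin m =>
          monoOp η ξ K (u - ((k : ℕ) : ℂ) * η) (d k) (c k)).prod
  simp only [Function.comp_apply] at h
  rw [← h]
  have hX : ∀ X : TensorOp n (Fin m ⊕ Fin N), auxTrace X = ∑ c, blocks n m N X c c := by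
    intro X
    ext s t
    simp [auxTrace, Matrix.sum_apply, blocks_apply]
  have hA : ∀ (A : TensorOp n (Fin m)) c d, blocks n m N (auxOp N A) c d = A c d • 1 := by
    intro A c d
    ext s t
    rw [blocks_apply]
    simp only [auxOp, Matrix.of_apply, Matrix.smul_apply, Matrix.one_apply, smul_eq_mul, mul_ite,
      mul_one, mul_zero, Sum.elim_comp_inr, Sum.elim_comp_inl]
    exact if_congr Iff.rfl rfl rfl
  rw [transfer, hX]
  refine Finset.sum_congr rfl fun c _ => ?_
  rw [map_mul, Matrix.mul_apply]
  refine Finset.sum_congr rfl fun d _ => ?_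
  rw [hA, map_list_prod, List.map_map, smul_mul_assoc, one_mul]
  have hb : (List.finRange m).map
      (blocks n m N ∘ fun a => monodromy m η ξ K a (u - ((a : ℕ) : ℂ) * η)) =
      (List.finRange m).map fun k : Fin m => localOp (monoOp η ξ K (u - ((k : ℕ) : ℂ) * η)) k :=
    List.map_congr_left fun k _ => blocks_monodromy η ξ K k _
  rw [hb]
  congr 1
  exact localOp_prod_finRange_apply _ d c

theorem transferInf_eq (K : Matrix (Fin n) (Fin n) ℂ) (m : ℕ) :
    transferInf K m = ((m.factorial : ℂ)⁻¹) •
      ∑ π : Equiv.Perm (Fin m), ((Equiv.Perm.sign π : ℤ) : ℂ) • ∑ d : Fin m → Fin n,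
        ((List.finRange m).map fun k : Fin m => K (d k) (d (π k))).prod := by
  have h := antisymmetrizer_mul_trace (n := n) fun d c : Fin m → Fin n =>
    ((List.finRange m).map fun k : Fin m => K (d k) (c k)).prod
  simp only [Function.comp_apply] at h
  rw [← h, transferInf, Matrix.trace]
  refine Finset.sum_congr rfl fun c _ => ?_
  rw [Matrix.diag_apply, Matrix.mul_apply]
  refine Finset.sum_congr rfl fun d _ => ?_
  rw [smul_eq_mul]
  congr 1
  exact localOp_prod_finRange_apply (fun _ => K) d c

end Blocks

/-! ### Exchange relations on two auxiliary spaces -/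

section TwoSpaces

variable {n : ℕ} {A : Type*} [Ring A]

/-- The operator `X_1 Y_2` on two auxiliary spaces, as a matrix with entries in `A`. -/
def tensor (X Y : Matrix (Fin n) (Fin n) A) : Matrix (Fin n × Fin n) (Fin n × Fin n) A :=
  Matrix.of fun p q => X p.1 q.1 * Y p.2 q.2

/-- The permutation of two auxiliary spaces. -/
def flipOp (n : ℕ) (A : Type*) [Ring A] : Matrix (Fin n × Fin n) (Fin n × Fin n) A :=
  Matrix.of fun p q => if p.swap = q then 1 else 0

theorem flipOp_mul_apply (Z : Matrix (Fin n × Fin n) (Fin n × Fin n) A) (p q : Fin n × Fin n) :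
    (flipOp n A * Z) p q = Z p.swap q := by
  simp [flipOp, Matrix.mul_apply]

theorem mul_flipOp_apply (Z : Matrix (Fin n × Fin n) (Fin n × Fin n) A) (p q : Fin n × Fin n) :
    (Z * flipOp n A) p q = Z p q.swap := by
  have h : ∀ j : Fin n × Fin n, j.swap = q ↔ j = q.swap := fun j => by
    constructor
    · rintro rfl; simp
    · rintro rfl; simp
  simp [flipOp, Matrix.mul_apply, h]

theorem flipOp_mul_self : flipOp n A * flipOp n A = 1 := by
  ext p q
  rw [flipOp_mul_apply]
  simp [flipOp, Matrix.one_apply]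

theorem tensor_mul {X Y X' Y' : Matrix (Fin n) (Fin n) A}
    (h : ∀ a b c d, Commute (Y a b) (X' c d)) :
    tensor X Y * tensor X' Y' = tensor (X * X') (Y * Y') := by
  ext p q
  simp only [tensor, Matrix.mul_apply, Matrix.of_apply, Finset.sum_mul_sum,
    Fintype.sum_prod_type]
  refine Finset.sum_congr rfl fun i _ => Finset.sum_congr rfl fun j _ => ?_
  rw [mul_assoc, ← mul_assoc (Y _ _), (h _ _ _ _).eq]
  simp only [mul_assoc]

theorem trace_tensor (X Y : Matrix (Fin n) (Fin n) A) :
    (tensor X Y).trace = X.trace * Y.trace := by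
  simp [Matrix.trace, tensor, Fintype.sum_prod_type, Finset.sum_mul_sum]

theorem trace_flipOp_mul (Z : Matrix (Fin n × Fin n) (Fin n × Fin n) A) :
    (flipOp n A * Z).trace = (Z * flipOp n A).trace := by
  simp only [Matrix.trace, Matrix.diag_apply, flipOp_mul_apply, mul_flipOp_apply]
  exact Fintype.sum_equiv (Equiv.prodComm _ _) _ _ fun p => by simp

theorem entry_commute_list_prod {ι : Type*} (L : ι → Matrix (Fin n) (Fin n) A) (l : List ι) (z : A)
    (h : ∀ i ∈ l, ∀ a b, Commute z (L i a b)) : ∀ a b, Commute z ((l.map L).prod a b) := by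
  induction l with
  | nil =>
    intro a b
    simp only [List.map_nil, List.prod_nil, Matrix.one_apply]
    split_ifs
    · exact Commute.one_right z
    · exact Commute.zero_right z
  | cons i l ih =>
    intro a b
    rw [List.map_cons, List.prod_cons, Matrix.mul_apply]
    exact Commute.sum_right _ _ _ fun k _ => (h i (by simp) a k).mul_right
      (ih (fun j hj => h j (by simp [hj])) k b)

theorem entry_commute_list_prod' {ι : Type*} {X Y : ι → Matrix (Fin n) (Fin n) A}
    (hc : ∀ i j, i ≠ j → ∀ a b c d, Commute (X i a b) (Y j c d)) {i : ι} {l : List ι} (hi : i ∉ l)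
    (a b c d : Fin n) : Commute (X i a b) ((l.map Y).prod c d) :=
  entry_commute_list_prod Y l _ (fun j hj c d => hc i j (fun h => hi (h ▸ hj)) a b c d) c d

variable [Algebra ℂ A]

/-- The operator `x P + η`. -/
def braid (n : ℕ) (A : Type*) [Ring A] [Algebra ℂ A] (x η : ℂ) :
    Matrix (Fin n × Fin n) (Fin n × Fin n) A := x • flipOp n A + η • 1

/-- The exchange relation of Yang-Baxter type for two matrices with noncommuting entries. -/
def Exchange (x η : ℂ) (X Y : Matrix (Fin n) (Fin n) A) : Prop :=
  braid n A x η * tensor X Y = tensor Y X * braid n A x η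

theorem Exchange.mul {x η : ℂ} {X Y X' Y' : Matrix (Fin n) (Fin n) A}
    (h : Exchange x η X Y) (h' : Exchange x η X' Y')
    (h1 : ∀ a b c d, Commute (Y a b) (X' c d)) (h2 : ∀ a b c d, Commute (X a b) (Y' c d)) :
    Exchange x η (X * X') (Y * Y') := by
  unfold Exchange at *
  rw [← tensor_mul h1, ← tensor_mul h2, ← mul_assoc, h, mul_assoc, h', mul_assoc]

/-- `braid x` is invertible up to the scalar `η² - x²`, with inverse `braid (-x)`, so `X ⊗ Y` and `Y
⊗ X` are conjugate. -/
theorem Exchange.trace_commute {x η : ℂ} {X Y : Matrix (Fin n) (Fin n) A}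
    (h : Exchange x η X Y) (hx : η ^ 2 - x ^ 2 ≠ 0) : Commute X.trace Y.trace := by
  have hJ : braid n A (-x) η * braid n A x η = (η ^ 2 - x ^ 2) • 1 := by
    simp only [braid, add_mul, mul_add, smul_mul_smul_comm, flipOp_mul_self, one_mul, mul_one]
    module
  have hJ' : braid n A x η * braid n A (-x) η = (η ^ 2 - x ^ 2) • 1 := by
    simp only [braid, add_mul, mul_add, smul_mul_smul_comm, flipOp_mul_self, one_mul, mul_one]
    module
  -- The trace over a noncommutative ring is not cyclic in general; it is here because `braid` is
  -- built from the identity and the flip with complex coefficients.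
  have htr : ∀ Z : Matrix (Fin n × Fin n) (Fin n × Fin n) A,
      (braid n A (-x) η * Z).trace = (Z * braid n A (-x) η).trace := by
    intro Z
    simp only [braid, add_mul, mul_add, smul_mul_assoc, mul_smul_comm, one_mul, mul_one,
      Matrix.trace_add, Matrix.trace_smul, trace_flipOp_mul]
  have h1 : (η ^ 2 - x ^ 2) • (tensor X Y).trace = (η ^ 2 - x ^ 2) • (tensor Y X).trace := by
    rw [← Matrix.trace_smul, ← Matrix.trace_smul]
    have e1 : (η ^ 2 - x ^ 2) • tensor X Y = braid n A (-x) η * (tensor Y X * braid n A x η) := by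
      rw [← h, ← mul_assoc, hJ, smul_mul_assoc, one_mul]
    rw [e1, htr, mul_assoc, hJ', mul_smul_comm, mul_one]
  have h2 := smul_right_injective A hx h1
  rwa [trace_tensor, trace_tensor] at h2

/-- At `x = η` the braid operator is `η` times `1 + P`, twice the symmetrizer. -/
theorem Exchange.one_add_flipOp {η : ℂ} (hη : η ≠ 0) {X Y : Matrix (Fin n) (Fin n) A}
    (h : Exchange η η X Y) : (1 + flipOp n A) * tensor X Y = tensor Y X * (1 + flipOp n A) := by
  have : braid n A η η = η • (1 + flipOp n A) := by rw [braid, smul_add, add_comm]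
  rw [Exchange, this, smul_mul_assoc, mul_smul_comm] at h
  exact smul_right_injective _ hη h

theorem exchange_list_prod {ι : Type*} {x η : ℂ} {X Y : ι → Matrix (Fin n) (Fin n) A}
    (hc : ∀ i j, i ≠ j → ∀ a b c d, Commute (X i a b) (Y j c d)) (he : ∀ i, Exchange x η (X i) (Y i))
    {l : List ι} (hl : l.Nodup) : Exchange x η (l.map X).prod (l.map Y).prod := by
  induction l with
  | nil =>
    have h1 : tensor (1 : Matrix (Fin n) (Fin n) A) 1 = 1 := by
      ext p q
      simp only [tensor, Matrix.of_apply, Matrix.one_apply, Prod.ext_iff]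
      split_ifs <;> simp_all
    simp [Exchange, h1]
  | cons i l ih =>
    rw [List.nodup_cons] at hl
    rw [List.map_cons, List.map_cons, List.prod_cons, List.prod_cons]
    exact (he i).mul (ih hl.2)
      (entry_commute_list_prod' (fun i j hij a b c d => (hc j i hij.symm c d a b).symm) hl.1)
      (entry_commute_list_prod' hc hl.1)

/-- The symmetrizer `1 + P` travels rightwards through the factors by the exchange relation until it
meets the factor `s`, which it annihilates. -/
theorem antisymm_list_prod {ι : Type*} {η : ℂ} (hη : η ≠ 0) {X Y : ι → Matrix (Fin n) (Fin n) A}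
    (hc : ∀ i j, i ≠ j → ∀ a b c d, Commute (X i a b) (Y j c d)) (he : ∀ i, Exchange η η (X i) (Y i))
    {s : ι} (hs : (1 + flipOp n A) * tensor (X s) (Y s) = 0) {l : List ι} (hl : l.Nodup)
    (hsl : s ∈ l) : (1 + flipOp n A) * tensor (l.map X).prod (l.map Y).prod = 0 := by
  classical
  induction l with
  | nil => simp at hsl
  | cons i l ih =>
    rw [List.nodup_cons] at hl
    rw [List.map_cons, List.map_cons, List.prod_cons, List.prod_cons, ← tensor_mul
      (entry_commute_list_prod' (fun i j hij a b c d => (hc j i hij.symm c d a b).symm) hl.1),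
      ← mul_assoc]
    by_cases h : i = s
    · subst h
      rw [hs, zero_mul]
    · rw [(he i).one_add_flipOp hη, mul_assoc,
        ih hl.2 ((List.mem_cons.1 hsl).resolve_left (Ne.symm h)), mul_zero]

theorem eq_zero_of_add_self {V : Type*} [AddCommGroup V] [Module ℂ V] {v : V} (h : v + v = 0) :
    v = 0 := by
  rw [← two_smul ℂ] at h
  exact (smul_eq_zero.1 h).resolve_left two_ne_zero

/-- The hypothesis on `S` reads `S = S P`, so `2S = S(1 + P)`. Moving `1 + P` through `T` puts it
next to `1 - P`, and `(1 + P)(1 - P) = 0`. -/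
theorem mul_one_sub_flipOp_eq_zero {S T U : Matrix (Fin n × Fin n) (Fin n × Fin n) A}
    (hS : S * (1 - flipOp n A) = 0) (hT : (1 + flipOp n A) * T = U * (1 + flipOp n A)) :
    S * T * (1 - flipOp n A) = 0 := by
  have h1 : S * flipOp n A = S := by
    rw [mul_sub, mul_one, sub_eq_zero] at hS
    exact hS.symm
  have h2 : S * ((1 + flipOp n A) * T) = S * T + S * T := by
    rw [← mul_assoc, mul_add, mul_one, h1, add_mul]
  have h3 : (1 + flipOp n A) * (1 - flipOp n A) = 0 := by
    simp [mul_sub, add_mul, flipOp_mul_self, add_comm]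
  refine eq_zero_of_add_self ?_
  rw [← add_mul, ← h2, hT, mul_assoc, mul_assoc, h3, mul_zero, mul_zero]

theorem symm_list_prod {ι : Type*} {η : ℂ} (hη : η ≠ 0) {X Y : ι → Matrix (Fin n) (Fin n) A}
    (hc : ∀ i j, i ≠ j → ∀ a b c d, Commute (X i a b) (Y j c d)) (he : ∀ i, Exchange η η (X i) (Y i))
    {s : ι} (hs : tensor (X s) (Y s) * (1 - flipOp n A) = 0) {l : List ι} (hl : l.Nodup)
    (hsl : s ∈ l) : tensor (l.map X).prod (l.map Y).prod * (1 - flipOp n A) = 0 := by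
  classical
  induction l with
  | nil => simp at hsl
  | cons i l ih =>
    rw [List.nodup_cons] at hl
    rw [List.map_cons, List.map_cons, List.prod_cons, List.prod_cons, ← tensor_mul
      (entry_commute_list_prod' (fun i j hij a b c d => (hc j i hij.symm c d a b).symm) hl.1)]
    by_cases h : i = s
    · subst h
      exact mul_one_sub_flipOp_eq_zero hs ((exchange_list_prod hc he hl.2).one_add_flipOp hη)
    · rw [mul_assoc, ih hl.2 ((List.mem_cons.1 hsl).resolve_left (Ne.symm h)), mul_zero]

end TwoSpaces

/-! ### Yang-Baxter relations for the Lax and monodromy matrices -/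

section Monodromy

variable {n N : ℕ}

theorem laxOp_apply (η : ℂ) (b : Fin N) (u : ℂ) (i j : Fin n) :
    laxOp η b u i j = (if i = j then u • 1 else 0) + η • elemOp b j i := rfl

theorem laxOp_commute (η : ℂ) {b c : Fin N} (h : b ≠ c) (u v : ℂ) (i j k l : Fin n) :
    Commute (laxOp η b u i j) (laxOp η c v k l) := by
  have hs : ∀ (w : ℂ) (p q : Fin n) (Z : TensorOp n (Fin N)),
      Commute (if p = q then w • (1 : TensorOp n (Fin N)) else 0) Z := by
    intro w p q Z
    split_ifs
    · exact (Commute.one_left Z).smul_left w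
    · exact Commute.zero_left Z
  rw [laxOp_apply, laxOp_apply]
  refine (hs _ _ _ _).add_left (Commute.add_right (hs _ _ _ _).symm ?_)
  exact ((elemOp_commute h _ _ _ _).smul_left _).smul_right _

/-- Kronecker deltas are kept as entries of the identity matrix, so that the quadratic identities
below become linear identities in `1` and the `elemOp`s. -/
theorem laxOp_mul_laxOp (η : ℂ) (b : Fin N) (u v : ℂ) (i j k l : Fin n) :
    laxOp η b u i j * laxOp η b v k l =
      (u * v * ((1 : Matrix (Fin n) (Fin n) ℂ) i j * (1 : Matrix (Fin n) (Fin n) ℂ) k l)) • 1 +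
      (u * η * (1 : Matrix (Fin n) (Fin n) ℂ) i j) • elemOp b l k +
      (v * η * (1 : Matrix (Fin n) (Fin n) ℂ) k l) • elemOp b j i +
      (η * η * (1 : Matrix (Fin n) (Fin n) ℂ) i l) • elemOp b j k := by
  have h : ∀ (w : ℂ) (p q : Fin n), (if p = q then w • (1 : TensorOp n (Fin N)) else 0) =
      (w * (1 : Matrix (Fin n) (Fin n) ℂ) p q) • 1 := by
    intro w p q
    rw [Matrix.one_apply]
    split_ifs <;> simp
  have h' : elemOp b j i * elemOp b l k =
      (1 : Matrix (Fin n) (Fin n) ℂ) i l • elemOp b j k := by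
    rw [elemOp_mul, Matrix.one_apply]
    split_ifs <;> simp
  rw [laxOp_apply, laxOp_apply, h, h, add_mul, mul_add, mul_add, smul_mul_smul_comm,
    smul_mul_smul_comm, smul_mul_smul_comm, smul_mul_smul_comm, h', one_mul, one_mul, mul_one]
  module

theorem laxOp_exchange (η : ℂ) (b : Fin N) (u v : ℂ) :
    Exchange (u - v) η (laxOp (n := n) η b u) (laxOp η b v) := by
  unfold Exchange
  refine Matrix.ext fun ⟨i, k⟩ ⟨j, l⟩ => ?_
  simp only [braid, add_mul, mul_add, smul_mul_assoc, mul_smul_comm, one_mul, mul_one,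
    Matrix.add_apply, Matrix.smul_apply, flipOp_mul_apply, mul_flipOp_apply, tensor,
    Matrix.of_apply, Prod.swap_prod_mk, laxOp_mul_laxOp]
  module

/-- In operator form `L_1(0) L_2(-η) = η² ℙ_{1b}(ℙ_{2b} - 1) = η² (ℙ_{12} - 1) ℙ_{1b}`, which `1 +
ℙ_{12}` kills. -/
theorem laxOp_antisymm (η : ℂ) (b : Fin N) :
    (1 + flipOp n _) * tensor (laxOp (n := n) η b 0) (laxOp η b (-η)) = 0 := by
  refine Matrix.ext fun ⟨i, k⟩ ⟨j, l⟩ => ?_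
  simp only [add_mul, one_mul, Matrix.add_apply, flipOp_mul_apply, tensor,
    Matrix.of_apply, Prod.swap_prod_mk, laxOp_mul_laxOp, Matrix.zero_apply]
  module

/-- In operator form `L_1(η) L_2(0) = η² (1 + ℙ_{1b}) ℙ_{2b} = η² ℙ_{2b}(1 + ℙ_{12})`, which `1 -
ℙ_{12}` kills. -/
theorem laxOp_symm (η : ℂ) (b : Fin N) :
    tensor (laxOp (n := n) η b η) (laxOp η b 0) * (1 - flipOp n _) = 0 := by
  refine Matrix.ext fun ⟨i, k⟩ ⟨j, l⟩ => ?_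
  simp only [mul_sub, mul_one, Matrix.sub_apply, mul_flipOp_apply, tensor,
    Matrix.of_apply, Prod.swap_prod_mk, laxOp_mul_laxOp, Matrix.zero_apply]
  module

theorem scalar_commute (K : Matrix (Fin n) (Fin n) ℂ) (i j : Fin n) (Z : TensorOp n (Fin N)) :
    Commute (K.map (algebraMap ℂ (TensorOp n (Fin N))) i j) Z :=
  Algebra.commutes (K i j) Z

theorem scalar_exchange (x η : ℂ) (K : Matrix (Fin n) (Fin n) ℂ) :
    Exchange x η (K.map (algebraMap ℂ (TensorOp n (Fin N)))) (K.map (algebraMap ℂ _)) := by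
  unfold Exchange
  refine Matrix.ext fun ⟨i, k⟩ ⟨j, l⟩ => ?_
  simp only [braid, add_mul, mul_add, smul_mul_assoc, mul_smul_comm, one_mul, mul_one,
    Matrix.add_apply, Matrix.smul_apply, flipOp_mul_apply, mul_flipOp_apply, tensor,
    Matrix.of_apply, Prod.swap_prod_mk]
  rw [(scalar_commute K k j _).eq]

variable (η : ℂ) (ξ : Fin N → ℂ) (K : Matrix (Fin n) (Fin n) ℂ)

theorem monoOp_exchange (u v : ℂ) : Exchange (u - v) η (monoOp η ξ K u) (monoOp η ξ K v) := by
  refine (scalar_exchange _ η K).mul (exchange_list_prod ?_ ?_ ?_)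
    (fun a b c d => scalar_commute K a b _) (fun a b c d => scalar_commute K a b _)
  · exact fun b c hbc i j k l => laxOp_commute η hbc _ _ i j k l
  · intro b
    have h := laxOp_exchange (n := n) η b (u - ξ b) (v - ξ b)
    rwa [sub_sub_sub_cancel_right] at h
  · exact List.nodup_reverse.2 (List.nodup_finRange N)

variable {η}

theorem monoOp_one_add_flipOp (hη : η ≠ 0) (u : ℂ) :
    (1 + flipOp n _) * tensor (monoOp η ξ K u) (monoOp η ξ K (u - η)) =
      tensor (monoOp η ξ K (u - η)) (monoOp η ξ K u) * (1 + flipOp n _) := by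
  have h := monoOp_exchange η ξ K u (u - η)
  rw [sub_sub_cancel] at h
  exact h.one_add_flipOp hη

theorem laxOp_shift_exchange (u : ℂ) (b : Fin N) :
    Exchange η η (laxOp (n := n) η b (u - ξ b)) (laxOp η b (u - η - ξ b)) := by
  have h := laxOp_exchange (n := n) η b (u - ξ b) (u - η - ξ b)
  rwa [sub_sub_sub_cancel_right, sub_sub_cancel] at h

theorem monoOp_antisymm (hη : η ≠ 0) (a : Fin N) :
    (1 + flipOp n _) * tensor (monoOp η ξ K (ξ a)) (monoOp η ξ K (ξ a - η)) = 0 := by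
  rw [monoOp, monoOp, ← tensor_mul fun i j _ _ => scalar_commute K i j _, ← mul_assoc,
    (scalar_exchange η η K).one_add_flipOp hη, mul_assoc,
    antisymm_list_prod hη (fun b c hbc i j k l => laxOp_commute η hbc _ _ i j k l)
      (laxOp_shift_exchange ξ (ξ a)) (s := a) ?_ (List.nodup_reverse.2 (List.nodup_finRange N))
      (by simp), mul_zero]
  have h := laxOp_antisymm (n := n) η a
  simpa using h

theorem monoOp_symm (hη : η ≠ 0) (a : Fin N) :
    tensor (monoOp η ξ K (ξ a + η)) (monoOp η ξ K (ξ a)) * (1 - flipOp n _) = 0 := by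
  have h := symm_list_prod hη (X := fun b => laxOp (n := n) η b (ξ a + η - ξ b))
    (Y := fun b => laxOp (n := n) η b (ξ a - ξ b))
    (fun b c hbc i j k l => laxOp_commute η hbc _ _ i j k l)
    (fun b => by simpa using laxOp_shift_exchange (n := n) (η := η) ξ (ξ a + η) b)
    (s := a) (by simpa using laxOp_symm (n := n) η a)
    (List.nodup_reverse.2 (List.nodup_finRange N)) (by simp)
  rw [monoOp, monoOp, ← tensor_mul fun i j _ _ => scalar_commute K i j _, mul_assoc, h, mul_zero]

/-- Entrywise form of `(1 + P) M_1(u) M_2(u - η) (1 - P) = 0`: antisymmetry in the column indices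
forces antisymmetry in the row indices. -/
theorem monoOp_exchange_apply (hη : η ≠ 0) (u : ℂ) (i j k l : Fin n) :
    monoOp η ξ K u i j * monoOp η ξ K (u - η) k l - monoOp η ξ K u i l * monoOp η ξ K (u - η) k j +
      (monoOp η ξ K u k j * monoOp η ξ K (u - η) i l -
        monoOp η ξ K u k l * monoOp η ξ K (u - η) i j) = 0 := by
  have h : (1 + flipOp n _) * tensor (monoOp η ξ K u) (monoOp η ξ K (u - η)) *
      (1 - flipOp n _) = 0 := by
    rw [monoOp_one_add_flipOp ξ K hη, mul_assoc]
    simp [mul_sub, add_mul, flipOp_mul_self, add_comm]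
  have := congrFun (congrFun h (i, k)) (j, l)
  simp only [add_mul, mul_sub, one_mul, mul_one, Matrix.add_apply, Matrix.sub_apply,
    flipOp_mul_apply, mul_flipOp_apply, tensor, Matrix.of_apply, Prod.swap_prod_mk,
    Matrix.zero_apply] at this
  rw [← this]
  abel

theorem monoOp_antisymm_apply (hη : η ≠ 0) (a : Fin N) (i j k l : Fin n) :
    monoOp η ξ K (ξ a) k j * monoOp η ξ K (ξ a - η) i l =
      -(monoOp η ξ K (ξ a) i j * monoOp η ξ K (ξ a - η) k l) := by
  have := congrFun (congrFun (monoOp_antisymm ξ K hη a) (i, k)) (j, l)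
  simp only [add_mul, one_mul, Matrix.add_apply,
    flipOp_mul_apply, tensor, Matrix.of_apply, Prod.swap_prod_mk,
    Matrix.zero_apply] at this
  exact (neg_eq_of_add_eq_zero_right this).symm

theorem monoOp_symm_apply (hη : η ≠ 0) (a : Fin N) (i j k l : Fin n) :
    monoOp η ξ K (ξ a + η) i l * monoOp η ξ K (ξ a) k j =
      monoOp η ξ K (ξ a + η) i j * monoOp η ξ K (ξ a) k l := by
  have := congrFun (congrFun (monoOp_symm ξ K hη a) (i, k)) (j, l)
  simp only [mul_sub, mul_one, Matrix.sub_apply,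
    mul_flipOp_apply, tensor, Matrix.of_apply, Prod.swap_prod_mk,
    Matrix.zero_apply] at this
  exact (sub_eq_zero.1 this).symm

end Monodromy

/-! ### Ordered products and antisymmetrized traces -/

section Words

variable {n m : ℕ} {A : Type*} [Ring A]

/-- The ordered product `M_0(x_0, y_0) M_1(x_1, y_1) ⋯`. -/
def wordOp (M : ℕ → Matrix (Fin n) (Fin n) A) (x y : Fin m → Fin n) : A :=
  ((List.finRange m).map fun k : Fin m => M k (x k) (y k)).prod

theorem finRange_succ_split (k : Fin m) : ∃ l₁ l₂ : List (Fin (m + 1)),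
    List.finRange (m + 1) = l₁ ++ k.castSucc :: k.succ :: l₂ := by
  refine ⟨(List.finRange (m + 1)).take k, (List.finRange (m + 1)).drop (k + 2), ?_⟩
  conv_lhs => rw [← List.take_append_drop k (List.finRange (m + 1))]
  rw [List.drop_eq_getElem_cons (by simp), List.drop_eq_getElem_cons (by simp)]
  simp only [List.getElem_finRange]
  rfl

/-- The same outer factors `α`, `β` serve for all four choices of swapping rows or columns at `k`,
`k + 1`, so any two-factor relation extends to whole words. -/
theorem wordOp_split (M : ℕ → Matrix (Fin n) (Fin n) A) (x y : Fin (m + 1) → Fin n) (k : Fin m) :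
    ∃ α β : A, ∀ σ ∈ ({1, Equiv.swap k.castSucc k.succ} : Set (Equiv.Perm (Fin (m + 1)))),
      ∀ τ ∈ ({1, Equiv.swap k.castSucc k.succ} : Set (Equiv.Perm (Fin (m + 1)))),
      wordOp M (x ∘ σ) (y ∘ τ) =
        α * (M k (x (σ k.castSucc)) (y (τ k.castSucc)) *
          M (k + 1) (x (σ k.succ)) (y (τ k.succ))) * β := by
  obtain ⟨l₁, l₂, hl⟩ := finRange_succ_split k
  have hnd := List.nodup_finRange (m + 1)
  rw [hl, List.nodup_append, List.nodup_cons, List.nodup_cons] at hnd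
  obtain ⟨-, ⟨h1, h2, -⟩, h3⟩ := hnd
  have hfix : ∀ j ∈ l₁ ++ l₂, ∀ σ ∈ ({1, Equiv.swap k.castSucc k.succ} :
      Set (Equiv.Perm (Fin (m + 1)))), σ j = j := by
    rintro j hj σ (rfl | rfl)
    · rfl
    · refine Equiv.swap_apply_of_ne_of_ne ?_ ?_ <;> rintro rfl
      · rcases List.mem_append.1 hj with h | h
        · exact h3 _ h _ (by simp) rfl
        · exact h1 (by simp [h])
      · rcases List.mem_append.1 hj with h | h
        · exact h3 _ h _ (by simp) rfl
        · exact h2 h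
  refine ⟨(l₁.map fun j : Fin (m + 1) => M j (x j) (y j)).prod, (l₂.map fun j : Fin (m + 1) => M j (x j) (y j)).prod,
    fun σ hσ τ hτ => ?_⟩
  rw [wordOp, hl, List.map_append, List.prod_append, List.map_cons, List.map_cons, List.prod_cons,
    List.prod_cons]
  have e1 : (l₁.map fun j : Fin (m + 1) => M j ((x ∘ σ) j) ((y ∘ τ) j)) =
      l₁.map fun j : Fin (m + 1) => M j (x j) (y j) := List.map_congr_left fun j hj => by
    simp [hfix j (by simp [hj]) σ hσ, hfix j (by simp [hj]) τ hτ]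
  have e2 : (l₂.map fun j : Fin (m + 1) => M j ((x ∘ σ) j) ((y ∘ τ) j)) =
      l₂.map fun j : Fin (m + 1) => M j (x j) (y j) := List.map_congr_left fun j hj => by
    simp [hfix j (by simp [hj]) σ hσ, hfix j (by simp [hj]) τ hτ]
  rw [e1, e2]
  simp only [mul_assoc, Function.comp_apply, Fin.val_castSucc, Fin.val_succ]

theorem wordOp_antisymm {M : ℕ → Matrix (Fin n) (Fin n) A} {k : Fin m}
    (h : ∀ i j p l, M k p j * M (k + 1) i l = -(M k i j * M (k + 1) p l))
    (x y : Fin (m + 1) → Fin n) :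
    wordOp M (x ∘ Equiv.swap k.castSucc k.succ) y = -wordOp M x y := by
  obtain ⟨α, β, hs⟩ := wordOp_split M x y k
  have e1 := hs (Equiv.swap k.castSucc k.succ) (by simp) 1 (by simp)
  have e2 := hs 1 (by simp) 1 (by simp)
  simp only [Equiv.Perm.coe_one, Function.comp_id, Equiv.swap_apply_left, Equiv.swap_apply_right,
    id_eq] at e1 e2
  rw [e1, e2, h]
  simp

theorem wordOp_symm {M : ℕ → Matrix (Fin n) (Fin n) A} {k : Fin m}
    (h : ∀ i j p l, M k i l * M (k + 1) p j = M k i j * M (k + 1) p l)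
    (x y : Fin (m + 1) → Fin n) :
    wordOp M x (y ∘ Equiv.swap k.castSucc k.succ) = wordOp M x y := by
  obtain ⟨α, β, hs⟩ := wordOp_split M x y k
  have e1 := hs 1 (by simp) (Equiv.swap k.castSucc k.succ) (by simp)
  have e2 := hs 1 (by simp) 1 (by simp)
  simp only [Equiv.Perm.coe_one, Function.comp_id, Equiv.swap_apply_left, Equiv.swap_apply_right,
    id_eq] at e1 e2
  rw [e1, e2, h]

theorem wordOp_exchange {M : ℕ → Matrix (Fin n) (Fin n) A} {k : Fin m}
    (h : ∀ i j p l, M k i j * M (k + 1) p l - M k i l * M (k + 1) p j +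
      (M k p j * M (k + 1) i l - M k p l * M (k + 1) i j) = 0)
    (x y : Fin (m + 1) → Fin n) :
    wordOp M x y - wordOp M x (y ∘ Equiv.swap k.castSucc k.succ) +
      (wordOp M (x ∘ Equiv.swap k.castSucc k.succ) y -
        wordOp M (x ∘ Equiv.swap k.castSucc k.succ) (y ∘ Equiv.swap k.castSucc k.succ)) = 0 := by
  obtain ⟨α, β, hs⟩ := wordOp_split M x y k
  have e1 := hs 1 (by simp) (Equiv.swap k.castSucc k.succ) (by simp)
  have e2 := hs 1 (by simp) 1 (by simp)
  have e3 := hs (Equiv.swap k.castSucc k.succ) (by simp) 1 (by simp)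
  have e4 := hs (Equiv.swap k.castSucc k.succ) (by simp) (Equiv.swap k.castSucc k.succ) (by simp)
  simp only [Equiv.Perm.coe_one, Function.comp_id, Equiv.swap_apply_left, Equiv.swap_apply_right,
    id_eq] at e1 e2 e3 e4
  rw [e1, e2, e3, e4, ← sub_mul, ← mul_sub, ← sub_mul, ← mul_sub, ← add_mul, ← mul_add, h]
  simp

theorem wordOp_cons (M : ℕ → Matrix (Fin n) (Fin n) A) (x y : Fin (m + 1) → Fin n) :
    wordOp M x y = M 0 (x 0) (y 0) * wordOp (fun k => M (k + 1)) (Fin.tail x) (Fin.tail y) := by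
  rw [wordOp, List.finRange_succ, List.map_cons, List.prod_cons, List.map_map]
  rfl

variable [Algebra ℂ A]

/-- The antisymmetrized trace of ordered products, without the factor `1 / m!`. -/
def altTrace (m : ℕ) (M : ℕ → Matrix (Fin n) (Fin n) A) : A :=
  ∑ π : Equiv.Perm (Fin m), ((Equiv.Perm.sign π : ℤ) : ℂ) • ∑ x, wordOp M x (x ∘ π)

/-- Words symmetric in two adjacent column indices cancel in pairs `π`, `π * swap` of opposite sign.
-/
theorem altTrace_eq_zero {M : ℕ → Matrix (Fin n) (Fin n) A} {k : Fin m}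
    (h : ∀ i j p l, M k i l * M (k + 1) p j = M k i j * M (k + 1) p l) :
    altTrace (m + 1) M = 0 := by
  refine eq_zero_of_add_self ?_
  nth_rewrite 2 [altTrace]
  rw [← Equiv.sum_comp (Equiv.mulRight (Equiv.swap k.castSucc k.succ)), altTrace,
    ← Finset.sum_add_distrib]
  refine Finset.sum_eq_zero fun π _ => ?_
  have hne : k.castSucc ≠ k.succ := Fin.castSucc_lt_succ.ne
  have hw : ∀ x : Fin (m + 1) → Fin n,
      wordOp M x (x ∘ π ∘ Equiv.swap k.castSucc k.succ) = wordOp M x (x ∘ π) := fun x =>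
    wordOp_symm h x (x ∘ π)
  simp [Equiv.Perm.sign_mul, Equiv.Perm.sign_swap hne, hw]

/-- The permutation of `Fin (m + 1)` fixing `0` and acting as `σ` on the other elements. -/
def liftPerm (σ : Equiv.Perm (Fin m)) : Equiv.Perm (Fin (m + 1)) :=
  Equiv.Perm.decomposeFin.symm (0, σ)

theorem liftPerm_zero (σ : Equiv.Perm (Fin m)) : liftPerm σ 0 = 0 := by simp [liftPerm]

theorem liftPerm_succ (σ : Equiv.Perm (Fin m)) (k : Fin m) : liftPerm σ k.succ = (σ k).succ := by
  simp [liftPerm]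

theorem sign_liftPerm (σ : Equiv.Perm (Fin m)) :
    Equiv.Perm.sign (liftPerm σ) = Equiv.Perm.sign σ := by
  simp [liftPerm]

theorem liftPerm_mul_swap (σ : Equiv.Perm (Fin m)) (i j : Fin m) :
    liftPerm (σ * Equiv.swap i j) = liftPerm σ * Equiv.swap i.succ j.succ := by
  refine Equiv.ext fun k => ?_
  refine Fin.cases ?_ (fun k => ?_) k
  · rw [liftPerm_zero, Equiv.Perm.mul_apply, Equiv.swap_apply_of_ne_of_ne
      (Fin.succ_ne_zero i).symm (Fin.succ_ne_zero j).symm, liftPerm_zero]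
  · rw [liftPerm_succ, Equiv.Perm.mul_apply, Equiv.Perm.mul_apply,
      (Fin.succ_injective m).swap_apply, liftPerm_succ]

/-- The ordered products, antisymmetrized in all column indices but the first. -/
def colAlt (M : ℕ → Matrix (Fin n) (Fin n) A) (x y : Fin (m + 1) → Fin n) : A :=
  ∑ σ : Equiv.Perm (Fin m), ((Equiv.Perm.sign σ : ℤ) : ℂ) • wordOp M x (y ∘ liftPerm σ)

/-! ### Factorization of the antisymmetrized trace -/

section Fusion

variable {M : ℕ → Matrix (Fin n) (Fin n) A}
  (h₀ : ∀ i j p l, M 0 p j * M 1 i l = -(M 0 i j * M 1 p l))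
  (h₁ : ∀ k i j p l, M k i j * M (k + 1) p l - M k i l * M (k + 1) p j +
      (M k p j * M (k + 1) i l - M k p l * M (k + 1) i j) = 0)
include h₀ h₁

/-- Rows `0, 1` are antisymmetric by `h₀`, with no condition on the columns. For later adjacent
rows, the antisymmetry of `colAlt` in the corresponding columns is transferred to the rows by `h₁`.
-/
theorem colAlt_swap (x y : Fin (m + 1) → Fin n) (k : Fin m) :
    colAlt M (x ∘ Equiv.swap k.castSucc k.succ) y = -colAlt M x y := by
  by_cases hk : (k : ℕ) = 0
  · simp only [colAlt, ← Finset.sum_neg_distrib, ← smul_neg]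
    refine Finset.sum_congr rfl fun σ _ => ?_
    rw [wordOp_antisymm (by simpa only [hk, zero_add] using h₀)]
  · obtain ⟨m, rfl⟩ : ∃ p, m = p + 1 := ⟨m - 1, by have := k.2; omega⟩
    obtain ⟨k, rfl⟩ := Fin.exists_succ_eq.2 (show k ≠ 0 from fun h => hk (by simp [h]))
    have hne : k.castSucc ≠ k.succ := Fin.castSucc_lt_succ.ne
    have hflip : ∀ x : Fin (m + 1 + 1) → Fin n, colAlt M x y =
        -∑ σ : Equiv.Perm (Fin (m + 1)), ((Equiv.Perm.sign σ : ℤ) : ℂ) •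
          wordOp M x ((y ∘ liftPerm σ) ∘ Equiv.swap k.succ.castSucc k.succ.succ) := by
      intro x
      rw [colAlt, ← Equiv.sum_comp (Equiv.mulRight (Equiv.swap k.castSucc k.succ)),
        ← Finset.sum_neg_distrib]
      refine Finset.sum_congr rfl fun σ _ => ?_
      simp only [Equiv.coe_mulRight, Equiv.Perm.sign_mul, Equiv.Perm.sign_swap hne,
        liftPerm_mul_swap, Equiv.Perm.coe_mul, Fin.succ_castSucc]
      simp [Function.comp_assoc]
    -- Doubling exhibits `colAlt` as a sum of column-antisymmetrized words, the shape in which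
    -- `wordOp_exchange` applies.
    have key : ∀ x : Fin (m + 1 + 1) → Fin n, colAlt M x y + colAlt M x y =
        ∑ σ : Equiv.Perm (Fin (m + 1)), ((Equiv.Perm.sign σ : ℤ) : ℂ) •
          (wordOp M x (y ∘ liftPerm σ) -
            wordOp M x ((y ∘ liftPerm σ) ∘ Equiv.swap k.succ.castSucc k.succ.succ)) := by
      intro x
      nth_rewrite 2 [hflip x]
      rw [colAlt, ← sub_eq_add_neg, ← Finset.sum_sub_distrib]
      simp only [smul_sub]
    refine eq_neg_of_add_eq_zero_left (eq_zero_of_add_self ?_)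
    rw [add_add_add_comm, key, key, ← Finset.sum_add_distrib]
    refine Finset.sum_eq_zero fun σ _ => ?_
    rw [← smul_add, (add_comm _ _).trans (wordOp_exchange (h₁ _) x (y ∘ liftPerm σ)), smul_zero]

theorem colAlt_perm (π : Equiv.Perm (Fin (m + 1))) (x y : Fin (m + 1) → Fin n) :
    colAlt M (x ∘ π) y = ((Equiv.Perm.sign π : ℤ) : ℂ) • colAlt M x y := by
  have hπ : π ∈ Submonoid.closure
      (Set.range fun i : Fin m => Equiv.swap i.castSucc i.succ) := by
    rw [Equiv.Perm.mclosure_swap_castSucc_succ]; trivial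
  induction hπ using Submonoid.closure_induction generalizing x with
  | mem π hπ =>
    obtain ⟨k, rfl⟩ := hπ
    have hne : k.castSucc ≠ k.succ := Fin.castSucc_lt_succ.ne
    simp [colAlt_swap h₀ h₁, Equiv.Perm.sign_swap hne]
  | one => simp
  | mul π ρ _ _ h1 h2 =>
    rw [Equiv.Perm.coe_mul, ← Function.comp_assoc, h2, h1, smul_smul, Equiv.Perm.sign_mul]
    push_cast
    rw [mul_comm]

/-- `colAlt` is already antisymmetric in all rows, so under the trace the full antisymmetrization
repeats the partial one `(m + 1)!` times; the factor `m!` comes from averaging over the subgroup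
fixing `0`. -/
theorem sum_colAlt : (m.factorial : ℂ) • altTrace (m + 1) M =
    ((m + 1).factorial : ℂ) • ∑ x : Fin (m + 1) → Fin n, colAlt M x x := by
  have hsq : ∀ π : Equiv.Perm (Fin (m + 1)),
      ((Equiv.Perm.sign π : ℤ) : ℂ) * ((Equiv.Perm.sign π : ℤ) : ℂ) = 1 := by
    intro π
    rw [← Int.cast_mul, ← Units.val_mul, Int.units_mul_self]; simp
  have h1 : ∀ σ : Equiv.Perm (Fin m), altTrace (m + 1) M =
      ∑ π : Equiv.Perm (Fin (m + 1)), ((Equiv.Perm.sign π : ℤ) : ℂ) •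
        ∑ x : Fin (m + 1) → Fin n,
          ((Equiv.Perm.sign σ : ℤ) : ℂ) • wordOp M x ((x ∘ π) ∘ liftPerm σ) := by
    intro σ
    rw [altTrace, ← Equiv.sum_comp (Equiv.mulRight (liftPerm σ))]
    refine Finset.sum_congr rfl fun π _ => ?_
    simp only [Equiv.coe_mulRight, Equiv.Perm.sign_mul, sign_liftPerm, ← Finset.smul_sum,
      smul_smul]
    push_cast
    rfl
  have h2 : (m.factorial : ℂ) • altTrace (m + 1) M =
      ∑ σ : Equiv.Perm (Fin m), altTrace (m + 1) M := by
    rw [Finset.sum_const, Finset.card_univ, Fintype.card_perm, Fintype.card_fin, Nat.cast_smul_eq_nsmul]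
  rw [h2, Finset.sum_congr rfl fun σ _ => h1 σ, Finset.sum_comm]
  have h3 : ∀ π : Equiv.Perm (Fin (m + 1)),
      ∑ σ : Equiv.Perm (Fin m), ((Equiv.Perm.sign π : ℤ) : ℂ) •
        ∑ x : Fin (m + 1) → Fin n,
          ((Equiv.Perm.sign σ : ℤ) : ℂ) • wordOp M x ((x ∘ π) ∘ liftPerm σ) =
      ∑ x : Fin (m + 1) → Fin n, colAlt M x x := by
    intro π
    rw [← Finset.smul_sum, Finset.sum_comm]
    have : ∀ x : Fin (m + 1) → Fin n, (∑ σ : Equiv.Perm (Fin m),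
        ((Equiv.Perm.sign σ : ℤ) : ℂ) • wordOp M x ((x ∘ π) ∘ liftPerm σ)) =
        colAlt M x (x ∘ π) := fun x => rfl
    simp only [this]
    -- Relabelling the summation index moves `π` from the columns to the rows, where it acts by its
    -- sign.
    have h4 : ∑ x : Fin (m + 1) → Fin n, colAlt M x (x ∘ π) =
        ∑ x : Fin (m + 1) → Fin n, colAlt M (x ∘ ⇑π⁻¹) x := by
      rw [← Equiv.sum_comp (Equiv.arrowCongr π (Equiv.refl (Fin n)))]
      refine Finset.sum_congr rfl fun x _ => ?_
      change colAlt M (x ∘ ⇑π⁻¹) ((x ∘ ⇑π⁻¹) ∘ π) = _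
      congr 1
      funext k
      simp
    rw [h4]
    simp only [colAlt_perm h₀ h₁, Equiv.Perm.sign_inv, ← Finset.smul_sum,
      smul_smul, hsq, one_smul]
  rw [Finset.sum_congr rfl fun π _ => h3 π, Finset.sum_const, Finset.card_univ, Fintype.card_perm,
    Fintype.card_fin, Nat.cast_smul_eq_nsmul]

/-- The permutations in `colAlt` fix `0`, so the first factor is traced on its own. -/
theorem altTrace_fusion : altTrace (m + 1) M =
    ((m + 1 : ℕ) : ℂ) • ((M 0).trace * altTrace m fun k => M (k + 1)) := by
  have h1 : ∑ x : Fin (m + 1) → Fin n, colAlt M x x =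
      (M 0).trace * altTrace m fun k => M (k + 1) := by
    simp only [colAlt]
    rw [Finset.sum_comm, altTrace, Finset.mul_sum]
    refine Finset.sum_congr rfl fun σ _ => ?_
    rw [← Finset.smul_sum, mul_smul_comm, Matrix.trace, Finset.sum_mul_sum]
    congr 1
    rw [← Equiv.sum_comp (Fin.consEquiv fun _ : Fin (m + 1) => Fin n), Fintype.sum_prod_type]
    refine Finset.sum_congr rfl fun i _ => Finset.sum_congr rfl fun x _ => ?_
    rw [wordOp_cons]
    congr 1
  have h2 := sum_colAlt (m := m) h₀ h₁
  rw [h1, Nat.factorial_succ, mul_comm, Nat.cast_mul, mul_smul] at h2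
  exact smul_right_injective A (Nat.cast_ne_zero.2 m.factorial_ne_zero) h2

end Fusion
end Words

/-! ### Fusion equations and central zeros -/

section Transfer

variable {n N : ℕ} {η : ℂ} (ξ : Fin N → ℂ) (K : Matrix (Fin n) (Fin n) ℂ)

theorem transfer_eq_altTrace (η : ℂ) (m : ℕ) (u : ℂ) :
    transfer η ξ K m u = ((m.factorial : ℂ)⁻¹) •
      altTrace m fun k => monoOp η ξ K (u - (k : ℂ) * η) :=
  transfer_eq η ξ K m u

theorem transfer_one (η : ℂ) (u : ℂ) : transfer η ξ K 1 u = (monoOp η ξ K u).trace := by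
  rw [transfer_eq_altTrace, altTrace, Fintype.sum_unique]
  simp [wordOp, Matrix.trace, List.finRange_succ]
  exact Fintype.sum_equiv (Equiv.funUnique (Fin 1) (Fin n)) _ _ fun _ => rfl

theorem transfer_fusion (hη : η ≠ 0) (m : ℕ) (a : Fin N) :
    transfer η ξ K (m + 1) (ξ a) = transfer η ξ K 1 (ξ a) * transfer η ξ K m (ξ a - η) := by
  have h := altTrace_fusion (m := m) (M := fun k : ℕ => monoOp η ξ K (ξ a - (k : ℂ) * η))
    (fun i j p l => by
      have h := monoOp_antisymm_apply ξ K hη a i j p l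
      simp only [Nat.cast_zero, zero_mul, sub_zero, Nat.cast_one, one_mul]
      exact h)
    (fun k i j p l => by
      have h := monoOp_exchange_apply ξ K hη (ξ a - (k : ℂ) * η) i j p l
      have e : ξ a - ((k + 1 : ℕ) : ℂ) * η = ξ a - (k : ℂ) * η - η := by push_cast; ring
      simp only [e]
      exact h)
  have e0 : ξ a - ((0 : ℕ) : ℂ) * η = ξ a := by simp
  have e : ∀ k : ℕ, ξ a - ((k + 1 : ℕ) : ℂ) * η = ξ a - η - (k : ℂ) * η := by
    intro k; push_cast; ring
  have hs : (((m + 1).factorial : ℂ)⁻¹) * ((m + 1 : ℕ) : ℂ) = (m.factorial : ℂ)⁻¹ := by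
    have := Nat.cast_ne_zero (R := ℂ).2 m.succ_ne_zero
    rw [Nat.factorial_succ, Nat.cast_mul, mul_inv, mul_comm, ← mul_assoc, mul_inv_cancel₀ this,
      one_mul]
  simp only [e, e0] at h
  rw [transfer_one, transfer_eq_altTrace, transfer_eq_altTrace, h, smul_smul, hs, mul_smul_comm]

theorem transfer_central_zero (hη : η ≠ 0) {m r : ℕ} (hr : 1 ≤ r) (hrm : r ≤ m) (a : Fin N) :
    transfer η ξ K (m + 1) (ξ a + (r : ℂ) * η) = 0 := by
  obtain ⟨k, rfl⟩ : ∃ k, r = k + 1 := ⟨r - 1, by omega⟩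
  rw [transfer_eq_altTrace, altTrace_eq_zero (k := ⟨k, hrm⟩), smul_zero]
  intro i j p l
  have := monoOp_symm_apply ξ K hη a i j p l
  -- At `ξ_a + (k + 1)η` the adjacent factors `k`, `k + 1` sit at `ξ_a + η` and `ξ_a`, the pair
  -- covered by `monoOp_symm`; `r ≤ m` ensures that both occur.
  have e1 : ξ a + ((k + 1 : ℕ) : ℂ) * η - (k : ℂ) * η = ξ a + η := by push_cast; ring
  have e2 : ξ a + ((k + 1 : ℕ) : ℂ) * η - ((k + 1 : ℕ) : ℂ) * η = ξ a := by ring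
  simp only [e1, e2]
  exact this

end Transfer

/-! ### Operator-valued polynomials and their uniqueness -/

section Polynomial

variable {n N : ℕ}

theorem isPolynomialOp_const (X : TensorOp n (Fin N)) : IsPolynomialOp fun _ => X :=
  fun s t => ⟨Polynomial.C (X s t), fun u => by simp⟩

theorem isPolynomialOp_eval_smul (p : Polynomial ℂ) (X : TensorOp n (Fin N)) :
    IsPolynomialOp fun u => p.eval u • X :=
  fun s t => ⟨p * Polynomial.C (X s t), fun u => by simp⟩

theorem IsPolynomialOp.add {F G : ℂ → TensorOp n (Fin N)} (hF : IsPolynomialOp F)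
    (hG : IsPolynomialOp G) : IsPolynomialOp fun u => F u + G u := fun s t => by
  obtain ⟨p, hp⟩ := hF s t
  obtain ⟨q, hq⟩ := hG s t
  exact ⟨p + q, fun u => by simp [hp, hq]⟩

theorem IsPolynomialOp.sum {ι : Type*} (l : Finset ι) {F : ι → ℂ → TensorOp n (Fin N)}
    (hF : ∀ i, IsPolynomialOp (F i)) : IsPolynomialOp fun u => ∑ i ∈ l, F i u := fun s t => by
  choose p hp using fun i => hF i s t
  exact ⟨∑ i ∈ l, p i, fun u => by simp [hp, Matrix.sum_apply, Polynomial.eval_finsetSum]⟩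

theorem IsPolynomialOp.mul {F G : ℂ → TensorOp n (Fin N)} (hF : IsPolynomialOp F)
    (hG : IsPolynomialOp G) : IsPolynomialOp fun u => F u * G u := fun s t => by
  choose p hp using hF
  choose q hq using hG
  exact ⟨∑ k, p s k * q k t, fun u => by
    simp [hp, hq, Matrix.mul_apply, Polynomial.eval_finsetSum]⟩

theorem IsPolynomialOp.const_smul {F : ℂ → TensorOp n (Fin N)} (hF : IsPolynomialOp F) (c : ℂ) :
    IsPolynomialOp fun u => c • F u := fun s t => by
  obtain ⟨p, hp⟩ := hF s t
  exact ⟨Polynomial.C c * p, fun u => by simp [hp]⟩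

theorem IsPolynomialOp.eval_smul {F : ℂ → TensorOp n (Fin N)} (hF : IsPolynomialOp F)
    (q : Polynomial ℂ) : IsPolynomialOp fun u => q.eval u • F u := fun s t => by
  obtain ⟨p, hp⟩ := hF s t
  exact ⟨q * p, fun u => by simp [hp]⟩

theorem IsPolynomialOp.list_prod {ι : Type*} (l : List ι) {F : ι → ℂ → TensorOp n (Fin N)}
    (hF : ∀ i, IsPolynomialOp (F i)) : IsPolynomialOp fun u => (l.map fun i => F i u).prod := by
  induction l with
  | nil => exact isPolynomialOp_const 1
  | cons i l ih => simpa using (hF i).mul ih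

theorem IsPolynomialOp.matrix_list_prod {ι : Type*} (l : List ι)
    {F : ι → ℂ → Matrix (Fin n) (Fin n) (TensorOp n (Fin N))}
    (hF : ∀ k i j, IsPolynomialOp fun u => F k u i j) (i j : Fin n) :
    IsPolynomialOp fun u => (l.map fun k => F k u).prod i j := by
  induction l generalizing i with
  | nil => exact isPolynomialOp_const ((1 : Matrix (Fin n) (Fin n) (TensorOp n (Fin N))) i j)
  | cons k l ih =>
    simp only [List.map_cons, List.prod_cons, Matrix.mul_apply]
    exact IsPolynomialOp.sum _ fun q => (hF k i q).mul (ih q)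

theorem IsPolynomialOp.eq_of_finite {F G : ℂ → TensorOp n (Fin N)} (hF : IsPolynomialOp F)
    (hG : IsPolynomialOp G) (s : Finset ℂ) (h : ∀ u ∉ s, F u = G u) : F = G := by
  funext u
  ext i j
  obtain ⟨p, hp⟩ := hF i j
  obtain ⟨q, hq⟩ := hG i j
  rw [hp, hq, Polynomial.eq_of_infinite_eval_eq p q]
  refine (Set.Finite.infinite_compl s.finite_toSet).mono fun v hv => ?_
  rw [Set.mem_ofPred_eq, ← hp, ← hq, h v hv]

theorem tendsto_inv_mul_sub (c : ℂ) :
    Tendsto (fun u : ℂ => u⁻¹ * (u - c)) (Bornology.cobounded ℂ) (𝓝 1) := by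
  have h : Tendsto (fun u : ℂ => 1 - u⁻¹ * c) (Bornology.cobounded ℂ) (𝓝 (1 - 0 * c)) :=
    tendsto_const_nhds.sub (tendsto_inv₀_cobounded.mul_const c)
  rw [zero_mul, sub_zero] at h
  refine h.congr' ?_
  filter_upwards [Bornology.eventually_ne_cobounded (0 : ℂ)] with u hu
  field_simp

theorem tendsto_inv_pow_mul_prod_sub {ι : Type*} (s : Finset ι) (f : ι → ℂ) :
    Tendsto (fun u : ℂ => (u ^ s.card)⁻¹ * ∏ i ∈ s, (u - f i)) (Bornology.cobounded ℂ) (𝓝 1) := by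
  have h := tendsto_finsetProd s fun i _ => tendsto_inv_mul_sub (f i)
  rw [Finset.prod_const_one] at h
  refine h.congr fun u => ?_
  rw [Finset.prod_mul_distrib, Finset.prod_const, inv_pow]

/-- Dividing by `∏ (X - z)` leaves a polynomial tending to `0` at infinity. Nonconstant polynomials
are unbounded there, so the quotient is a constant, namely `0`. -/
theorem polynomial_eq_zero_of_tendsto (p : Polynomial ℂ) (s : Finset ℂ)
    (hs : ∀ z ∈ s, p.eval z = 0)
    (h : Tendsto (fun u => (u ^ s.card)⁻¹ * p.eval u) (Bornology.cobounded ℂ) (𝓝 0)) : p = 0 := by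
  obtain ⟨g, rfl⟩ : ∏ z ∈ s, (Polynomial.X - Polynomial.C z) ∣ p :=
    Finset.prod_dvd_of_coprime
      ((Polynomial.pairwise_coprime_X_sub_C Function.injective_id).set_pairwise _)
      fun z hz => Polynomial.dvd_iff_isRoot.2 (hs z hz)
  have h1 := tendsto_inv_pow_mul_prod_sub s id
  have h2 : Tendsto (fun u => g.eval u) (Bornology.cobounded ℂ) (𝓝 0) := by
    have h3 := h.div h1 one_ne_zero
    rw [zero_div] at h3
    refine h3.congr' ?_
    filter_upwards [h1.eventually_ne one_ne_zero] with u hu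
    rw [Pi.div_apply, div_eq_iff hu]
    simp only [Polynomial.eval_mul, Polynomial.eval_prod, Polynomial.eval_sub, Polynomial.eval_X,
      Polynomial.eval_C, id]
    ring
  suffices hg : g = 0 by rw [hg, mul_zero]
  rcases lt_or_ge 0 g.degree with hd | hd
  · have h4 := Polynomial.tendsto_norm_atTop g hd (z := fun u : ℂ => u)
      tendsto_norm_cobounded_atTop
    exact absurd h2.norm (not_tendsto_nhds_of_tendsto_atTop h4 _)
  · rw [Polynomial.eq_C_of_degree_le_zero hd] at h2 ⊢
    simp only [Polynomial.eval_C] at h2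
    rw [tendsto_nhds_unique tendsto_const_nhds h2, map_zero]

theorem IsPolynomialOp.eq_of_hasAsymptotics {F G : ℂ → TensorOp n (Fin N)}
    (hF : IsPolynomialOp F) (hG : IsPolynomialOp G) {d : ℕ} {c : ℂ}
    (hF' : HasAsymptotics F d c) (hG' : HasAsymptotics G d c) (l : Finset ℂ) (hl : l.card = d)
    (h : ∀ z ∈ l, F z = G z) : F = G := by
  subst hl
  funext u
  ext s t
  obtain ⟨p, hp⟩ := hF s t
  obtain ⟨q, hq⟩ := hG s t
  have hpq : p - q = 0 := by
    refine polynomial_eq_zero_of_tendsto _ l (fun z hz => ?_) ?_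
    · rw [Polynomial.eval_sub, ← hp, ← hq, h z hz, sub_self]
    · have h1 := tendsto_pi_nhds.1 (tendsto_pi_nhds.1 (hF'.sub hG') s) t
      rw [sub_self] at h1
      refine h1.congr fun u => ?_
      simp only [Matrix.sub_apply, Matrix.smul_apply, hp, hq, smul_eq_mul, Polynomial.eval_sub,
        mul_sub]
  rw [hp, hq, sub_eq_zero.1 hpq]

end Polynomial

/-! ### Polynomiality, asymptotics and commutation of the transfer matrices -/

section Transfer

variable {n N : ℕ} (η : ℂ) (ξ : Fin N → ℂ) (K : Matrix (Fin n) (Fin n) ℂ)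

theorem isPolynomialOp_laxOp (b : Fin N) (c : ℂ) (i j : Fin n) :
    IsPolynomialOp fun u => laxOp η b (u - c) i j := by
  simp only [laxOp_apply]
  refine IsPolynomialOp.add ?_ (isPolynomialOp_const _)
  split_ifs
  · have h := isPolynomialOp_eval_smul (Polynomial.X - Polynomial.C c) (1 : TensorOp n (Fin N))
    simp only [Polynomial.eval_sub, Polynomial.eval_X, Polynomial.eval_C] at h
    exact h
  · exact isPolynomialOp_const 0

theorem isPolynomialOp_monoOp (c : ℂ) (i j : Fin n) :
    IsPolynomialOp fun u => monoOp η ξ K (u - c) i j := by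
  simp only [monoOp, Matrix.mul_apply]
  refine IsPolynomialOp.sum _ fun k => (isPolynomialOp_const _).mul ?_
  refine IsPolynomialOp.matrix_list_prod _ (fun b i j => ?_) k j
  simpa only [sub_sub] using isPolynomialOp_laxOp η b (c + ξ b) i j

theorem isPolynomialOp_transfer (m : ℕ) : IsPolynomialOp (transfer η ξ K m) := by
  have h : transfer η ξ K m = fun u => transfer η ξ K m u := rfl
  rw [h]
  simp only [transfer_eq]
  refine (IsPolynomialOp.sum _ fun π => (IsPolynomialOp.sum _ fun x => ?_).const_smul _).const_smul _
  exact IsPolynomialOp.list_prod _ fun k => isPolynomialOp_monoOp η ξ K _ _ _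

theorem tendsto_laxOp (b : Fin N) (c : ℂ) :
    Tendsto (fun u : ℂ => u⁻¹ • laxOp (n := n) η b (u - c)) (Bornology.cobounded ℂ) (𝓝 1) := by
  have h : Tendsto (fun u : ℂ => 1 + u⁻¹ • laxOp (n := n) η b (-c)) (Bornology.cobounded ℂ)
      (𝓝 (1 + (0 : ℂ) • laxOp (n := n) η b (-c))) :=
    tendsto_const_nhds.add (tendsto_inv₀_cobounded.smul_const _)
  rw [zero_smul, add_zero] at h
  refine h.congr' ?_
  filter_upwards [Bornology.eventually_ne_cobounded (0 : ℂ)] with u hu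
  have e : laxOp (n := n) η b (u - c) = u • 1 + laxOp η b (-c) := by
    refine Matrix.ext fun i j => ?_
    rw [Matrix.add_apply, Matrix.smul_apply, Matrix.one_apply, laxOp_apply, laxOp_apply]
    split_ifs
    · module
    · simp
  rw [e, smul_add, smul_smul, inv_mul_cancel₀ hu, one_smul]

theorem tendsto_monoOp (c : ℂ) :
    Tendsto (fun u : ℂ => (u ^ N)⁻¹ • monoOp η ξ K (u - c)) (Bornology.cobounded ℂ)
      (𝓝 (K.map (algebraMap ℂ (TensorOp n (Fin N))))) := by
  have h := tendsto_list_prod (f := fun b u => u⁻¹ • laxOp (n := n) η b (u - (c + ξ b)))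
    (List.finRange N).reverse fun b _ => tendsto_laxOp η b (c + ξ b)
  have h' := (tendsto_const_nhds (x := K.map (algebraMap ℂ (TensorOp n (Fin N))))).mul h
  rw [List.map_const', List.prod_replicate, one_pow, mul_one] at h'
  refine h'.congr fun u => ?_
  have e := List.smul_prod ((List.finRange N).reverse.map fun b =>
    laxOp (n := n) η b (u - (c + ξ b))) u⁻¹
  rw [List.map_map, List.length_map, List.length_reverse, List.length_finRange] at e
  simp only [monoOp, sub_sub]
  rw [← mul_smul_comm, ← inv_pow, e]
  rfl

theorem hasAsymptotics_transfer (m : ℕ) :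
    HasAsymptotics (transfer η ξ K m) (m * N) (transferInf K m) := by
  have h : ∀ x y : Fin m → Fin n, Tendsto (fun u : ℂ => ((u ^ (m * N))⁻¹ •
      ((List.finRange m).map fun k : Fin m =>
          monoOp η ξ K (u - ((k : ℕ) : ℂ) * η) (x k) (y k)).prod)) (Bornology.cobounded ℂ)
      (𝓝 (((List.finRange m).map fun k : Fin m => K (x k) (y k)).prod • 1)) := by
    intro x y
    have h1 := tendsto_list_prod (f := fun (k : Fin m) u =>
      (u ^ N)⁻¹ • monoOp η ξ K (u - ((k : ℕ) : ℂ) * η) (x k) (y k))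
      (List.finRange m) fun k _ =>
        tendsto_pi_nhds.1 (tendsto_pi_nhds.1 (tendsto_monoOp η ξ K (((k : ℕ) : ℂ) * η)) (x k)) (y k)
    have e : ((List.finRange m).map fun k : Fin m =>
        K.map (algebraMap ℂ (TensorOp n (Fin N))) (x k) (y k)).prod =
        ((List.finRange m).map fun k : Fin m => K (x k) (y k)).prod • 1 := by
      rw [← Algebra.algebraMap_eq_smul_one, map_list_prod, List.map_map]
      rfl
    rw [e] at h1
    refine h1.congr fun u => ?_
    have e := List.smul_prod ((List.finRange m).map fun k : Fin m =>
      monoOp η ξ K (u - ((k : ℕ) : ℂ) * η) (x k) (y k)) (u ^ N)⁻¹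
    rw [List.map_map, List.length_map, List.length_finRange, inv_pow, ← pow_mul, mul_comm N] at e
    rw [e]
    rfl
  have h2 := (tendsto_finsetSum Finset.univ fun (π : Equiv.Perm (Fin m)) _ =>
    (tendsto_finsetSum Finset.univ fun (x : Fin m → Fin n) _ =>
      h x (x ∘ π)).const_smul ((Equiv.Perm.sign π : ℤ) : ℂ)).const_smul (m.factorial : ℂ)⁻¹
  unfold HasAsymptotics
  rw [transferInf_eq]
  simp only [smul_assoc, Finset.sum_smul]
  refine h2.congr fun u => ?_
  rw [transfer_eq]
  simp only [Finset.smul_sum, smul_comm (u ^ (m * N))⁻¹, Function.comp_apply]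

theorem transfer_one_commute (u v : ℂ) :
    Commute (transfer η ξ K 1 u) (transfer η ξ K 1 v) := by
  have hp := isPolynomialOp_transfer η ξ K 1
  -- The braid operator is singular only at `u = v ± η`; polynomiality in `u` covers these two
  -- points.
  have h := IsPolynomialOp.eq_of_finite (hp.mul (isPolynomialOp_const (transfer η ξ K 1 v)))
    ((isPolynomialOp_const (transfer η ξ K 1 v)).mul hp) {v + η, v - η} fun u hu => by
      rw [transfer_one, transfer_one]
      refine (monoOp_exchange η ξ K u v).trace_commute fun h => hu ?_
      have h1 : (u - (v + η)) * (u - (v - η)) = 0 := by linear_combination -h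
      rcases mul_eq_zero.1 h1 with h | h
      · simp [sub_eq_zero.1 h]
      · simp [sub_eq_zero.1 h]
  exact congrFun h u

end Transfer

/-! ### Interpolation at the inhomogeneities -/

section Interpolation

variable {n N : ℕ} (η : ℂ) (ξ : Fin N → ℂ)

theorem gFun_zero (m : ℕ) (a : Fin N) (u : ℂ) :
    gFun η ξ (m + 1) a 0 u = (∏ b ∈ Finset.univ.erase a, (u - ξ b)) *
      ((∏ b ∈ Finset.univ.erase a, (ξ a - ξ b)) *
        ∏ b, ∏ r ∈ Finset.Icc 1 m, (ξ a - ξ b - (r : ℂ) * η))⁻¹ := by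
  have e : ∀ (b : Fin N) (r : ℕ), ξ a - (ξ b + (r : ℂ) * η) = ξ a - ξ b - (r : ℂ) * η :=
    fun b r => by ring
  have hI : Finset.Ico 1 (m + 1) = Finset.Icc 1 m := by ext; simp
  simp only [gFun, xiShift, Pi.zero_apply, Int.cast_zero, zero_mul, sub_zero, Int.cast_neg,
    Int.cast_natCast, neg_mul, sub_neg_eq_add, e, hI, Finset.prod_div_distrib, one_div,
    Finset.prod_inv_distrib, mul_inv]
  rw [div_eq_mul_inv, mul_assoc]

/-- The operator-valued polynomial with central zeros `ξ_b + r η`, `1 ≤ r ≤ m`, values `C a` at the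
points `ξ_a` and leading coefficient `c`. -/
def interpolant (m : ℕ) (c : ℂ) (C : Fin N → TensorOp n (Fin N)) (u : ℂ) : TensorOp n (Fin N) :=
  (∏ b : Fin N, ∏ r ∈ Finset.Icc 1 m, (u - ξ b - (r : ℂ) * η)) •
    ((c * ∏ b, (u - ξ b)) • (1 : TensorOp n (Fin N)) + ∑ a : Fin N, gFun η ξ (m + 1) a 0 u • C a)

variable (m : ℕ) (c : ℂ) (C : Fin N → TensorOp n (Fin N))

theorem isPolynomialOp_interpolant : IsPolynomialOp (interpolant η ξ m c C) := by
  have h1 : IsPolynomialOp fun u => (c * ∏ b, (u - ξ b)) • (1 : TensorOp n (Fin N)) := by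
    have h := isPolynomialOp_eval_smul
      (Polynomial.C c * ∏ b, (Polynomial.X - Polynomial.C (ξ b))) (1 : TensorOp n (Fin N))
    simp only [Polynomial.eval_mul, Polynomial.eval_prod, Polynomial.eval_sub, Polynomial.eval_X,
      Polynomial.eval_C] at h
    exact h
  have h2 : ∀ a, IsPolynomialOp fun u => gFun η ξ (m + 1) a 0 u • C a := by
    intro a
    have h := isPolynomialOp_eval_smul
      ((∏ b ∈ Finset.univ.erase a, (Polynomial.X - Polynomial.C (ξ b))) *
        Polynomial.C (((∏ b ∈ Finset.univ.erase a, (ξ a - ξ b)) *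
        ∏ b, ∏ r ∈ Finset.Icc 1 m, (ξ a - ξ b - (r : ℂ) * η))⁻¹)) (C a)
    simp only [Polynomial.eval_mul, Polynomial.eval_prod, Polynomial.eval_sub, Polynomial.eval_X,
      Polynomial.eval_C] at h
    simp only [gFun_zero]
    exact h
  have h3 := (h1.add (IsPolynomialOp.sum Finset.univ h2)).eval_smul
    (∏ b : Fin N, ∏ r ∈ Finset.Icc 1 m,
      (Polynomial.X - Polynomial.C (ξ b) - Polynomial.C ((r : ℂ) * η)))
  simp only [Polynomial.eval_prod, Polynomial.eval_sub, Polynomial.eval_X, Polynomial.eval_C] at h3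
  exact h3

theorem tendsto_gFun (a : Fin N) : Tendsto (fun u : ℂ => (u ^ N)⁻¹ * gFun η ξ (m + 1) a 0 u)
    (Bornology.cobounded ℂ) (𝓝 0) := by
  have h := ((tendsto_inv₀_cobounded (α := ℂ)).mul
    (tendsto_inv_pow_mul_prod_sub (Finset.univ.erase a) ξ)).mul_const
    (((∏ b ∈ Finset.univ.erase a, (ξ a - ξ b)) *
        ∏ b, ∏ r ∈ Finset.Icc 1 m, (ξ a - ξ b - (r : ℂ) * η))⁻¹)
  rw [zero_mul, zero_mul] at h
  refine h.congr fun u => ?_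
  -- The numerator has only `N - 1` factors, which leaves one spare `u⁻¹` to force the limit `0`.
  have hc : N = (Finset.univ.erase a).card + 1 := by
    rw [Finset.card_erase_add_one (Finset.mem_univ a), Finset.card_univ, Fintype.card_fin]
  have hp : (u ^ N)⁻¹ = u⁻¹ * (u ^ (Finset.univ.erase a).card)⁻¹ := by
    conv_lhs => rw [hc]
    rw [pow_succ', mul_inv]
  rw [gFun_zero, hp]
  ring

theorem hasAsymptotics_interpolant :
    HasAsymptotics (interpolant η ξ m c C) ((m + 1) * N) c := by
  have h1 : Tendsto (fun u : ℂ => (u ^ (m * N))⁻¹ *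
      ∏ b : Fin N, ∏ r ∈ Finset.Icc 1 m, (u - ξ b - (r : ℂ) * η)) (Bornology.cobounded ℂ) (𝓝 1) := by
    have h := tendsto_inv_pow_mul_prod_sub ((Finset.univ : Finset (Fin N)) ×ˢ Finset.Icc 1 m)
      fun p => ξ p.1 + (p.2 : ℂ) * η
    simp only [Finset.card_product, Finset.card_univ, Fintype.card_fin, Nat.card_Icc,
      Nat.add_sub_cancel, Finset.prod_product, ← sub_sub, mul_comm N m] at h
    exact h
  have h2 := tendsto_inv_pow_mul_prod_sub Finset.univ ξ
  rw [Finset.card_univ, Fintype.card_fin] at h2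
  have h3 := h1.smul (((h2.const_mul c).smul_const (1 : TensorOp n (Fin N))).add
    (tendsto_finsetSum Finset.univ fun a _ => (tendsto_gFun η ξ m a).smul_const (C a)))
  simp only [mul_one, zero_smul, Finset.sum_const_zero, add_zero, one_smul] at h3
  refine h3.congr fun u => ?_
  have hp : (u ^ ((m + 1) * N))⁻¹ = (u ^ (m * N))⁻¹ * (u ^ N)⁻¹ := by
    rw [add_mul, one_mul, pow_add, mul_inv]
  have hN : (c * ((u ^ N)⁻¹ * ∏ b, (u - ξ b))) • (1 : TensorOp n (Fin N)) +
      ∑ a, ((u ^ N)⁻¹ * gFun η ξ (m + 1) a 0 u) • C a =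
      (u ^ N)⁻¹ • ((c * ∏ b, (u - ξ b)) • (1 : TensorOp n (Fin N)) +
        ∑ a, gFun η ξ (m + 1) a 0 u • C a) := by
    rw [smul_add, smul_smul, Finset.smul_sum, mul_left_comm]
    simp only [smul_smul]
  rw [hN, interpolant, hp, smul_smul, smul_smul, mul_right_comm]

theorem interpolant_central_zero {r : ℕ} (hr : 1 ≤ r) (hrm : r ≤ m) (a : Fin N) :
    interpolant η ξ m c C (ξ a + (r : ℂ) * η) = 0 := by
  rw [interpolant, Finset.prod_eq_zero (Finset.mem_univ a)
    (Finset.prod_eq_zero (Finset.mem_Icc.2 ⟨hr, hrm⟩) (by ring)), zero_smul]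

variable {η ξ m}

theorem interpolant_apply_xi (hη : η ≠ 0)
    (hξ : ∀ a b : Fin N, a ≠ b → ∀ r : ℕ, r < m + 1 → ξ a - ξ b ≠ (r : ℂ) * η) (a : Fin N) :
    interpolant η ξ m c C (ξ a) = C a := by
  have h0 : (∏ b ∈ Finset.univ.erase a, (ξ a - ξ b)) ≠ 0 := by
    refine Finset.prod_ne_zero_iff.2 fun b hb => ?_
    simpa using hξ a b (Finset.ne_of_mem_erase hb).symm 0 (Nat.succ_pos m)
  have h1 : (∏ b : Fin N, ∏ r ∈ Finset.Icc 1 m, (ξ a - ξ b - (r : ℂ) * η)) ≠ 0 := by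
    refine Finset.prod_ne_zero_iff.2 fun b _ => Finset.prod_ne_zero_iff.2 fun r hr => ?_
    rw [Finset.mem_Icc] at hr
    -- The diagonal factors are `-rη`, nonzero because `r ≥ 1`; the others are nonzero by
    -- genericity.
    by_cases hab : a = b
    · subst hab
      have : (r : ℂ) ≠ 0 := Nat.cast_ne_zero.2 (by omega)
      simp [this, hη]
    · exact sub_ne_zero.2 (hξ a b hab r (by omega))
  have h2 : ∏ b, (ξ a - ξ b) = 0 := Finset.prod_eq_zero (Finset.mem_univ a) (sub_self _)
  rw [interpolant, h2, mul_zero, zero_smul, zero_add, Finset.sum_eq_single a, gFun_zero, smul_smul,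
    mul_inv, mul_inv_cancel_left₀ h0, mul_inv_cancel₀ h1, one_smul]
  · intro b _ hb
    rw [gFun_zero, Finset.prod_eq_zero (Finset.mem_erase.2 ⟨hb.symm, Finset.mem_univ a⟩)
      (sub_self _), zero_mul, zero_smul]
  · simp

/-- A polynomial of degree `(m + 1) N` is determined by its leading coefficient and its values at
the points `ξ_a + r η`, `0 ≤ r ≤ m`. -/
theorem eq_of_eq_at_points (hη : η ≠ 0)
    (hξ : ∀ a b : Fin N, a ≠ b → ∀ r : ℕ, r < m + 1 → ξ a - ξ b ≠ (r : ℂ) * η)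
    {F G : ℂ → TensorOp n (Fin N)} (hF : IsPolynomialOp F) (hG : IsPolynomialOp G)
    (hF' : HasAsymptotics F ((m + 1) * N) c) (hG' : HasAsymptotics G ((m + 1) * N) c)
    (h0 : ∀ a, F (ξ a) = G (ξ a))
    (h : ∀ a, ∀ r : ℕ, 1 ≤ r → r ≤ m → F (ξ a + (r : ℂ) * η) = G (ξ a + (r : ℂ) * η)) :
    F = G := by
  -- A coincidence of two nodes would give `ξ_a - ξ_b = (r - s)η`; ordering `s ≤ r` keeps the
  -- difference a natural number below `m + 1`.
  have hle : ∀ (a b : Fin N) (r s : ℕ), r < m + 1 → s ≤ r →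
      ξ b + (r : ℂ) * η = ξ a + (s : ℂ) * η → a = b ∧ r = s := by
    intro a b r s hr hs e
    have e' : ξ a - ξ b = ((r - s : ℕ) : ℂ) * η := by
      rw [Nat.cast_sub hs]; linear_combination -e
    by_cases hab : a = b
    · subst hab
      refine ⟨rfl, ?_⟩
      exact_mod_cast mul_right_cancel₀ hη (add_left_cancel e)
    · exact absurd e' (hξ a b hab _ (by omega))
  have hinj : Set.InjOn (fun p : Fin N × ℕ => ξ p.1 + (p.2 : ℂ) * η)
      ((Finset.univ : Finset (Fin N)) ×ˢ Finset.range (m + 1) : Finset _) := by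
    rintro ⟨a, r⟩ hr ⟨b, s⟩ hs e
    simp only [Finset.coe_product, Set.mem_prod, Finset.mem_coe, Finset.mem_range] at hr hs e
    rcases le_total s r with h | h
    · obtain ⟨rfl, rfl⟩ := hle b a r s hr.2 h e; rfl
    · obtain ⟨rfl, rfl⟩ := hle a b s r hs.2 h e.symm; rfl
  refine hF.eq_of_hasAsymptotics hG hF' hG' (((Finset.univ : Finset (Fin N)) ×ˢ
    Finset.range (m + 1)).image fun p => ξ p.1 + (p.2 : ℂ) * η) ?_ ?_
  · rw [Finset.card_image_of_injOn hinj, Finset.card_product, Finset.card_univ, Fintype.card_fin,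
      Finset.card_range, mul_comm]
  · intro z hz
    obtain ⟨⟨a, r⟩, hr, rfl⟩ := Finset.mem_image.1 hz
    rw [Finset.mem_product, Finset.mem_range] at hr
    rcases Nat.eq_zero_or_pos r with rfl | h1
    · simpa using h0 a
    · exact h a r h1 (Nat.lt_succ_iff.1 hr.2)

variable (K : Matrix (Fin n) (Fin n) ℂ)

theorem transfer_eq_interpolant (hη : η ≠ 0)
    (hξ : ∀ a b : Fin N, a ≠ b → ∀ r : ℕ, r < m + 1 → ξ a - ξ b ≠ (r : ℂ) * η) :
    transfer η ξ K (m + 1) = interpolant η ξ m (transferInf K (m + 1)) fun a =>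
      transfer η ξ K 1 (ξ a) * transfer η ξ K m (ξ a - η) := by
  refine eq_of_eq_at_points _ hη hξ (isPolynomialOp_transfer η ξ K _)
    (isPolynomialOp_interpolant η ξ m _ _) (hasAsymptotics_transfer η ξ K _)
    (hasAsymptotics_interpolant η ξ m _ _) (fun a => ?_) fun a r hr hrm => ?_
  · rw [interpolant_apply_xi _ _ hη hξ, transfer_fusion ξ K hη]
  · rw [interpolant_central_zero η ξ m _ _ hr hrm, transfer_central_zero ξ K hη hr hrm]

/-- By interpolation `T_{m+1}(u)` is a combination of `1` and the products `T_1(ξ_a) T_m(ξ_a - η)`,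
so commutation with `T_1(v)` propagates from `T_1` by induction. -/
theorem transfer_commute (hη : η ≠ 0) {m : ℕ} (hm : 1 ≤ m)
    (hξ : ∀ a b : Fin N, a ≠ b → ∀ r : ℕ, r < m → ξ a - ξ b ≠ (r : ℂ) * η) (u v : ℂ) :
    Commute (transfer η ξ K m u) (transfer η ξ K 1 v) := by
  induction m, hm using Nat.le_induction generalizing u with
  | base => exact transfer_one_commute η ξ K u v
  | succ m hm ih =>
    rw [transfer_eq_interpolant K hη hξ, interpolant]
    refine Commute.smul_left (((Commute.one_left _).smul_left _).add_left
      (Commute.sum_left _ _ _ fun a _ => Commute.smul_left ?_ _)) _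
    exact (transfer_one_commute η ξ K _ v).mul_left
      (ih (fun a b hab r hr => hξ a b hab r (by omega)) _)

end Interpolation
end FusedTransfer
end

/-! ### The interpolation formula and the characterization by `T_1` -/

open FusedTransfer
theorem corollary2p1 (n N : ℕ) (hn : 1 ≤ n) (η : ℂ) (hη : η ≠ 0) (ξ : Fin N → ℂ)
    (hξ : ∀ a b : Fin N, a ≠ b → ∀ r : ℕ, r < n → ξ a - ξ b ≠ (r : ℂ) * η)
    (K : Matrix (Fin n) (Fin n) ℂ) :
    -- the interpolation formulae
    (∀ m : ℕ, 1 ≤ m → m + 1 ≤ n → ∀ u : ℂ,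
      transfer η ξ K (m + 1) u =
        (∏ b : Fin N, ∏ r ∈ Finset.Icc 1 m, (u - ξ b - (r : ℂ) * η)) •
          (transferInfFun η ξ K (m + 1) 0 u • (1 : TensorOp n (Fin N)) +
            ∑ a : Fin N, gFun η ξ (m + 1) a 0 u •
              (transfer η ξ K m (ξ a - η) * transfer η ξ K 1 (ξ a)))) ∧
    -- `T_1` characterizes all the `T_m` through the fusion equations, the central zeros and
    -- the asymptotics
    (∀ S : ℕ → ℂ → TensorOp n (Fin N),
      (∀ m : ℕ, 1 ≤ m → m ≤ n → S m = transfer η ξ K m) ↔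
        (S 1 = transfer η ξ K 1 ∧
          ∀ m : ℕ, 1 ≤ m → m + 1 ≤ n →
            IsPolynomialOp (S (m + 1)) ∧
            HasAsymptotics (S (m + 1)) ((m + 1) * N) (transferInf K (m + 1)) ∧
            (∀ a : Fin N, S (m + 1) (ξ a) = S 1 (ξ a) * S m (ξ a - η)) ∧
            (∀ a : Fin N, ∀ r : ℕ, 1 ≤ r → r ≤ m →
              S (m + 1) (ξ a + (r : ℂ) * η) = 0))) := by
  have hξ' : ∀ m : ℕ, m + 1 ≤ n → ∀ a b : Fin N, a ≠ b → ∀ r : ℕ, r < m + 1 →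
      ξ a - ξ b ≠ (r : ℂ) * η := fun m hm a b hab r hr => hξ a b hab r (by omega)
  refine ⟨fun m hm hmn u => ?_, fun S => ⟨fun h => ⟨h 1 le_rfl hn, fun m hm hmn => ?_⟩, ?_⟩⟩
  · have hT : ∀ a, transfer η ξ K m (ξ a - η) * transfer η ξ K 1 (ξ a) =
        transfer η ξ K 1 (ξ a) * transfer η ξ K m (ξ a - η) := fun a =>
      (transfer_commute K hη hm (fun a b hab r hr => hξ a b hab r (by omega)) _ _).eq
    rw [transfer_eq_interpolant K hη (hξ' m hmn), interpolant]
    simp only [hT, transferInfFun, xiShift, Pi.zero_apply, Int.cast_zero, zero_mul, sub_zero]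
  · rw [h (m + 1) (by omega) hmn, h 1 le_rfl hn, h m hm (by omega)]
    exact ⟨isPolynomialOp_transfer η ξ K _, hasAsymptotics_transfer η ξ K _,
      transfer_fusion ξ K hη m, fun a r hr hrm => transfer_central_zero ξ K hη hr hrm a⟩
  · rintro ⟨h1, hS⟩ m hm
    induction m, hm using Nat.le_induction with
    | base => exact fun _ => h1
    | succ m hm ih =>
      intro hmn
      obtain ⟨hp, ha, hf, hz⟩ := hS m hm hmn
      refine eq_of_eq_at_points _ hη (hξ' m hmn) hp (isPolynomialOp_transfer η ξ K _) ha
        (hasAsymptotics_transfer η ξ K _) (fun a => ?_) fun a r hr hrm => ?_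
      · rw [hf, h1, ih (by omega), transfer_fusion ξ K hη m]
      · rw [hz a r hr hrm, transfer_central_zero ξ K hη hr hrm]
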